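/- Let $\kappa_1<\dots<\kappa_n$ be real parameters that are generic in the sense that for each $2\le d\le k$ the sums $\sum_{m=1}^d\kappa_{j_m}$ over the $d$-element subsets $\{j_1<\dots<j_d\}\subseteq[n]$ are all distinct. **Cells.** For a full-rank real $k\times n$ matrix $A$ and a $k$-subset $I$ of $[n]$ let $\Delta_I(A)$ be the maximal minor in the columns $I$. For $\mathcal M\subseteq\binom{[n]}{k}$ the positroid cell $S^{tnn}_{\mathcal M}\subseteq (Gr_{kn})_{\ge 0}$ consists of the points represented by matrices $A$ with $\Delta_I(A)>0$ for $I\in\mathcal M$ and $\Delta_J(A)=0$ for $J\notin\mathcal M$. It is irreducible if the reduced row echelon matrix of any of its points has a nonzero element in each column and, in each row, a nonzero element in addition to the pivot. The Grassmann necklace of $\mathcal M$ is $(I_1,\dots,I_n)$, where $I_r$ is the element of $\mathcal M$ that is lexicographically minimal for the order $r<r+1<\dots<n<1<\dots<r-1$. For a permutation $\pi\in S_n$, the cell $S_\pi^{tnn}$ is the cell $S^{tnn}_{\mathcal M}$ whose necklace satisfies, for every $i$ (indices modulo $n$), $I_{i+1}=(I_i\setminus\{i\})\cup\{j\}$ with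 some $j\ne i$ and $\pi(j)=i$. **Contour plots.** Let $A$ represent a point of $S^{tnn}_{\mathcal M}$ and put $$f_A(x,y,t)=\max_{J\in\mathcal M}\Bigl\{\ln\bigl(\Delta_J(A)K_J\bigr)+\sum_{j\in J}(\kappa_jx+\kappa_j^2y+\kappa_j^3t)\Bigr\},\qquad K_J=\prod_{l<m,\; l,m\in J}(\kappa_m-\kappa_l).$$ The contour plot $\mathcal C_{t_0}(u_A)$ is the set of points of the $xy$-plane near which $f_A(\cdot,\cdot,t_0)$ is not an affine-linear function. Its regions are the connected components of its complement; on each region a single term, with index set $J$ say, attains the maximum, and the region is labeled by $E_J$. A line-soliton is a line segment (possibly a ray or a line) along which two distinct regions are adjacent; it is of type $[i,j]$, $i<j$, if the labels of these two regions have index sets $S\cup\{i\}$ and $S\cup\{j\}$ with $i,j\notin S$. An unbounded line-soliton at $y\gg0$ (at $y\ll0$) is one that meets the horizontal line at height $y$ for all sufficiently large $y$ (for all sufficiently negative $y$). **Theorem.** Suppose that $A$ is an element of an irreducible positroid cell in $(Gr_{kn})_{\ge0}$, and let $t_0\in\mathbb R$. Then in $\mathcal C_{t_0}(u_A)$ there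 are exactly $k$ unbounded line-solitons at $y\gg0$, of types $[e_r,j_r]$ with $e_r<j_r$ $(1\le r\le k)$, and exactly $n-k$ unbounded line-solitons at $y\ll0$, of types $[i_r,g_r]$ with $i_r<g_r$ $(1\le r\le n-k)$. Each element of $[n]$ occurs exactly once among $e_1,\dots,e_k,g_1,\dots,g_{n-k}$, and setting $\pi(e_r)=j_r$ and $\pi(g_r)=i_r$ defines a derangement $\pi\in S_n$ with exactly $k$ excedances (positions $a$ with $\pi(a)>a$). Moreover, $A$ is an element of the cell $S_\pi^{tnn}$. -/

import Mathlib

open Set Filter Topology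

noncomputable section

namespace KPSoliton

/-- The set of `k`-element subsets of `[n]` (the elements `1, …, n` of `[n]` are represented by
the elements `0, …, n - 1` of `Fin n`, in the same order). -/
abbrev KSubset (k n : ℕ) : Type := {I : Finset (Fin n) // I.card = k}

/-! ### The totally non-negative Grassmannian -/

/-- The maximal minor `Δ_I(A)` of a `k × n` matrix located in the column set `I`
(columns taken in increasing order). -/
def minor {k n : ℕ} (A : Matrix (Fin k) (Fin n) ℝ) (I : KSubset k n) : ℝ :=
  (A.submatrix id (I.1.orderEmbOfFin I.2)).det

/-- The positroid cell `S_M^{tnn}`, given by the full-rank `k × n` matrices representing its points: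
`Δ_I(A) > 0` for `I ∈ M` and `Δ_J(A) = 0` for `J ∉ M`. -/
def positroidCell {k n : ℕ} (M : Set (KSubset k n)) : Set (Matrix (Fin k) (Fin n) ℝ) :=
  {A | A.rank = k ∧ (∀ I ∈ M, 0 < minor A I) ∧ ∀ J ∉ M, minor A J = 0}

/-- `E` is a reduced row echelon matrix of full rank, with pivot of row `r` in column `p r`. -/
structure IsRREF {k n : ℕ} (E : Matrix (Fin k) (Fin n) ℝ) (p : Fin k → Fin n) : Prop where
  pivot_strictMono : StrictMono p
  pivot_one : ∀ r, E r (p r) = 1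
  left_of_pivot : ∀ r c, c < p r → E r c = 0
  pivot_column : ∀ r s, s ≠ r → E s (p r) = 0

/-- The cell `S_M^{tnn}` is irreducible: the reduced row echelon matrix of any of its points
has a nonzero element in each column, and in each row a nonzero element besides the pivot. -/
def IsIrreducibleCell {k n : ℕ} (M : Set (KSubset k n)) : Prop :=
  ∀ B ∈ positroidCell M, ∃ (E : Matrix (Fin k) (Fin n) ℝ) (p : Fin k → Fin n),
    IsRREF E p ∧ (∃ g : Matrix (Fin k) (Fin k) ℝ, IsUnit g.det ∧ E = g * B) ∧
    (∀ c, ∃ r, E r c ≠ 0) ∧ (∀ r, ∃ c, c ≠ p r ∧ E r c ≠ 0)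

/-! ### Grassmann necklaces and permutations -/

/-- The order `r < r + 1 < ⋯ < n < 1 < ⋯ < r - 1` on `[n]` (subtraction is modulo `n`). -/
def ShiftedLT {n : ℕ} (r a b : Fin n) : Prop := a - r < b - r

/-- For sets of equal size, `I` precedes `J` lexicographically with respect to the order starting
at `r`: the smallest element at which the two sets differ belongs to `I`. -/
def LexLT {k n : ℕ} (r : Fin n) (I J : KSubset k n) : Prop :=
  ∃ a, a ∈ I.1 ∧ a ∉ J.1 ∧ ∀ b, ShiftedLT r b a → (b ∈ I.1 ↔ b ∈ J.1)

/-- `N = (I_1, …, I_n)` is the Grassmann necklace of `M`: `I_r` is the element of `M` that is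
lexicographically minimal with respect to the order starting at `r`. -/
def IsNecklaceOf {k n : ℕ} (M : Set (KSubset k n)) (N : Fin n → KSubset k n) : Prop :=
  ∀ r, N r ∈ M ∧ ∀ J ∈ M, J ≠ N r → LexLT r (N r) J

/-- `π` is the permutation of the necklace `N`: `π(j) = i` whenever
`I_{i+1} = (I_i \ {i}) ∪ {j}` with `j ≠ i`, indices modulo `n`. -/
def IsPermOfNecklace {k n : ℕ} (N : Fin n → KSubset k n) (π : Equiv.Perm (Fin n)) : Prop :=
  ∀ i, ∃ j, j ≠ i ∧ (N (finRotate n i)).1 = insert j ((N i).1.erase i) ∧ π j = i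

/-- The cell `S_π^{tnn}`: the positroid cell `S_M^{tnn}` whose necklace has permutation `π`. -/
def positroidCellOfPerm (k : ℕ) {n : ℕ} (π : Equiv.Perm (Fin n)) :
    Set (Matrix (Fin k) (Fin n) ℝ) :=
  {A | ∃ (M : Set (KSubset k n)) (N : Fin n → KSubset k n),
    A ∈ positroidCell M ∧ IsNecklaceOf M N ∧ IsPermOfNecklace N π}

/-! ### Contour plots and line-solitons -/

/-- Genericity of the parameters: for each `2 ≤ d ≤ k`, the sums of `d` of the `κ`s
(with distinct indices) are all distinct. -/
def IsGeneric (k : ℕ) {n : ℕ} (κ : Fin n → ℝ) : Prop :=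
  ∀ I J : Finset (Fin n), I.card = J.card → 2 ≤ I.card → I.card ≤ k →
    ∑ i ∈ I, κ i = ∑ i ∈ J, κ i → I = J

/-- `K_J = ∏_{l < m} (κ_{j_m} - κ_{j_l})` for `J = {j_1 < ⋯ < j_k}`. -/
def vandermondeFactor {k n : ℕ} (κ : Fin n → ℝ) (J : KSubset k n) : ℝ :=
  ∏ i ∈ J.1, ∏ j ∈ J.1 with i < j, (κ j - κ i)

/-- The logarithm `ln (Δ_J(A) K_J) + ∑_{j ∈ J} (κ_j x + κ_j² y + κ_j³ t)` of the exponential term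
`Δ_J(A) E_J` of the `τ`-function, as a function of `p = (x, y)`. -/
def logTerm {k n : ℕ} (κ : Fin n → ℝ) (A : Matrix (Fin k) (Fin n) ℝ) (t : ℝ)
    (J : KSubset k n) (p : ℝ × ℝ) : ℝ :=
  Real.log (minor A J * vandermondeFactor κ J) +
    ∑ j ∈ J.1, (κ j * p.1 + κ j ^ 2 * p.2 + κ j ^ 3 * t)

/-- `f_A(x, y, t)`: the maximum of the logarithms of the terms that occur in the `τ`-function
(a maximum over a finite set, nonempty when `A` has full rank). -/
def fA {k n : ℕ} (κ : Fin n → ℝ) (A : Matrix (Fin k) (Fin n) ℝ) (t : ℝ) (p : ℝ × ℝ) : ℝ :=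
  ⨆ J : {J : KSubset k n // minor A J ≠ 0}, logTerm κ A t J.1 p

/-- The contour plot at time `t`: the locus in the `xy`-plane where `f_A(·, ·, t)` is not linear,
that is, does not agree near the point with a function `a x + b y + c`. -/
def contourPlot {k n : ℕ} (κ : Fin n → ℝ) (A : Matrix (Fin k) (Fin n) ℝ) (t : ℝ) :
    Set (ℝ × ℝ) :=
  {p | ¬ ∃ a b c : ℝ, ∀ᶠ q in 𝓝 p, fA κ A t q = a * q.1 + b * q.2 + c}

/-- The regions of the contour plot: the connected components of its complement. -/
def IsRegion {k n : ℕ} (κ : Fin n → ℝ) (A : Matrix (Fin k) (Fin n) ℝ) (t : ℝ)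
    (U : Set (ℝ × ℝ)) : Prop :=
  ∃ p ∈ (contourPlot κ A t)ᶜ, U = connectedComponentIn (contourPlot κ A t)ᶜ p

/-- `E_J` is the dominant exponential of the region `U`. -/
def IsDominantOn {k n : ℕ} (κ : Fin n → ℝ) (A : Matrix (Fin k) (Fin n) ℝ) (t : ℝ)
    (J : KSubset k n) (U : Set (ℝ × ℝ)) : Prop :=
  minor A J ≠ 0 ∧ ∀ p ∈ U, fA κ A t p = logTerm κ A t J p

/-- `L` is the line segment (possibly a ray or a line) of the contour plot along which the two
distinct regions `U` and `V` are adjacent. -/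
def IsBorder {k n : ℕ} (κ : Fin n → ℝ) (A : Matrix (Fin k) (Fin n) ℝ) (t : ℝ)
    (U V L : Set (ℝ × ℝ)) : Prop :=
  IsRegion κ A t U ∧ IsRegion κ A t V ∧ U ≠ V ∧ L = closure U ∩ closure V ∧ L.Nontrivial

/-- `L` is a line-soliton: one of the line segments comprising the contour plot. -/
def IsLineSoliton {k n : ℕ} (κ : Fin n → ℝ) (A : Matrix (Fin k) (Fin n) ℝ) (t : ℝ)
    (L : Set (ℝ × ℝ)) : Prop :=
  ∃ U V, IsBorder κ A t U V L

/-- The line-soliton `L` is of type `[i, j]`, where `i < j`: the dominant exponentials in the two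
adjacent regions are `E(i, m_2, …, m_k)` and `E(j, m_2, …, m_k)`. -/
def HasType {k n : ℕ} (κ : Fin n → ℝ) (A : Matrix (Fin k) (Fin n) ℝ) (t : ℝ)
    (L : Set (ℝ × ℝ)) (i j : Fin n) : Prop :=
  i < j ∧ ∃ (U V : Set (ℝ × ℝ)) (I J : KSubset k n) (S : Finset (Fin n)),
    IsBorder κ A t U V L ∧ IsDominantOn κ A t I U ∧ IsDominantOn κ A t J V ∧
    i ∉ S ∧ j ∉ S ∧ I.1 = insert i S ∧ J.1 = insert j S

/-- The unbounded line-solitons at `y ≫ 0`. -/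
def upperSolitons {k n : ℕ} (κ : Fin n → ℝ) (A : Matrix (Fin k) (Fin n) ℝ) (t : ℝ) :
    Set (Set (ℝ × ℝ)) :=
  {L | IsLineSoliton κ A t L ∧ ∀ᶠ y : ℝ in atTop, ∃ x : ℝ, (x, y) ∈ L}

/-- The unbounded line-solitons at `y ≪ 0`. -/
def lowerSolitons {k n : ℕ} (κ : Fin n → ℝ) (A : Matrix (Fin k) (Fin n) ℝ) (t : ℝ) :
    Set (Set (ℝ × ℝ)) :=
  {L | IsLineSoliton κ A t L ∧ ∀ᶠ y : ℝ in atBot, ∃ x : ℝ, (x, y) ∈ L}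

end KPSoliton

end

/-! Index sets of terms in the τ-function are the bases `I` of the column configuration of `A`.
Along a ray in direction `(m, s)`, with `s = 1` upwards and `s = -1` downwards, the term of `I`
grows at the rate `∑ i ∈ I, (κ i * m + s * κ i ^ 2)`, so unbounded boundaries come from directions
in which two bases tie for maximal weight; `t` enters only the constant terms.

A matroid exchange argument settles these ties. The weights of `a` and `b` agree exactly when `m =
-s * (κ a + κ b)`. Genericity, or `k ≤ 1`, prevents two exchanges from taking place at once, and two
optimal bases occur exactly when the columns `a` and `b` are exchangeable modulo the span of the
heavier columns (`IsMaxBasis.exists_exchange`, `IsMaxBasis.exists_pair`). The results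
`exists_direction` and `unbounded_boundary` translate between ties and unbounded boundaries.

Since the weight is quadratic in `κ l`, the heavier indices are those with `s * (κ l - κ a) * (κ l -
κ b) > 0`: outside `[a, b]` for `s = 1`, strictly between `a` and `b` for `s = -1`. Both are open
cyclic intervals, from `b` to `a` and from `a` to `b` respectively. Exchangeability modulo such an
interval is the rule by which the Grassmann necklace evolves: `i` is replaced by the first `j` at
which column `i` enters the span of its cyclic successors. Hence upper solitons are the pairs `[a, π
a]` with `a < π a`, lower ones the pairs `[π b, b]` with `π b < b`. Irreducibility rules out loops
and coloops, which makes `π` a derangement; its excedances form the lexicographically first basis,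
so there are `k` of them. -/

namespace KPSoliton

/-! ### Bases of a vector configuration and maximal weight -/

section VectorConfiguration

variable {ι V : Type*} [AddCommGroup V] [Module ℝ V]

/-- The vectors `v i`, `i ∈ I`, form a basis of the ambient space. -/
def IsColumnBasis (v : ι → V) (I : Finset ι) : Prop :=
  LinearIndepOn ℝ v (I : Set ι) ∧ ⊤ ≤ Submodule.span ℝ (v '' (I : Set ι))

/-- `v a` lies in the span of `H ∪ {b}` but not in the span of `H`. -/
def SpanExchange (v : ι → V) (H : Set ι) (a b : ι) : Prop :=
  v a ∈ Submodule.span ℝ (v '' insert b H) ∧ v a ∉ Submodule.span ℝ (v '' H)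

theorem span_image_le_of_forall_mem {v : ι → V} {H : Set ι} {W : Submodule ℝ V}
    (h : ∀ l ∈ H, v l ∈ W) : Submodule.span ℝ (v '' H) ≤ W := by
  rw [Submodule.span_le]
  rintro _ ⟨l, hl, rfl⟩
  exact h l hl

theorem mem_span_image {v : ι → V} {H : Set ι} {l : ι} (h : l ∈ H) :
    v l ∈ Submodule.span ℝ (v '' H) :=
  Submodule.subset_span (mem_image_of_mem v h)

theorem span_image_mono {v : ι → V} {H K : Set ι} (h : H ⊆ K) :
    Submodule.span ℝ (v '' H) ≤ Submodule.span ℝ (v '' K) :=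
  Submodule.span_mono (image_mono h)

/-- Modulo the span of `H` the two vectors are nonzero multiples of each other. -/
theorem SpanExchange.symm {v : ι → V} {H : Set ι} {a b : ι} (h : SpanExchange v H a b) :
    SpanExchange v H b a := by
  obtain ⟨h1, h2⟩ := h
  rw [image_insert_eq] at h1
  refine ⟨?_, fun hb => h2 ?_⟩
  · rw [image_insert_eq]
    exact mem_span_insert_exchange h1 h2
  · rwa [Submodule.span_insert_eq_span hb] at h1

namespace IsColumnBasis

variable [DecidableEq ι] {v : ι → V} {I J : Finset ι}

theorem notMem_span_erase (hI : IsColumnBasis v I) {s : ι} (hs : s ∈ I) :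
    v s ∉ Submodule.span ℝ (v '' (↑(I.erase s) : Set ι)) := by
  have h := hI.1
  rw [← Finset.insert_erase hs, Finset.coe_insert] at h
  exact h.notMem_span_of_insert (by simp)

theorem exchange (hI : IsColumnBasis v I) {s l : ι} (hs : s ∈ I)
    (hl : v l ∉ Submodule.span ℝ (v '' (↑(I.erase s) : Set ι))) :
    IsColumnBasis v (insert l (I.erase s)) := by
  have hsp : v l ∈ Submodule.span ℝ (insert (v s) (v '' (↑(I.erase s) : Set ι))) := by
    rw [← image_insert_eq, ← Finset.coe_insert, Finset.insert_erase hs]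
    exact hI.2 trivial
  refine ⟨?_, fun x _ => ?_⟩
  · rw [Finset.coe_insert]
    exact (hI.1.mono (by simp)).insert hl
  · have hx := hI.2 (show x ∈ ⊤ from trivial)
    refine span_image_le_of_forall_mem (fun i hi => ?_) hx
    by_cases his : i = s
    · subst his
      rw [Finset.coe_insert, image_insert_eq]
      exact mem_span_insert_exchange hsp hl
    · exact mem_span_image (by simp_all)

/-- The indices `s` in this set are those at which `v l` has a nonzero coordinate in the basis `I`.
-/
theorem mem_span_support (hI : IsColumnBasis v I) (l : ι) :
    v l ∈ Submodule.span ℝ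
      (v '' {s | s ∈ I ∧ v l ∉ Submodule.span ℝ (v '' (↑(I.erase s) : Set ι))}) := by
  let b := Module.Basis.mk (v := fun i : (I : Set ι) => v i) hI.1
    (by rw [← image_eq_range]; exact hI.2)
  have hb : ∀ i, b i = v i := fun i => by simp [b]
  have h1 : v l ∈ Submodule.span ℝ (b '' (b.repr (v l)).support) :=
    b.mem_span_image.2 subset_rfl
  refine Submodule.span_mono ?_ h1
  rintro _ ⟨s, hs, rfl⟩
  refine ⟨s, ⟨s.2, fun hmem => ?_⟩, (hb s).symm⟩
  have h2 : v l ∈ Submodule.span ℝ (b '' {s}ᶜ) := by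
    refine Submodule.span_mono ?_ hmem
    rintro _ ⟨t, ht, rfl⟩
    have ht' : t ≠ s ∧ t ∈ I := Finset.mem_erase.1 (Finset.mem_coe.1 ht)
    exact ⟨⟨t, ht'.2⟩, fun h => ht'.1 (by simpa using congrArg Subtype.val h), hb _⟩
  exact b.mem_span_image.1 h2 hs rfl

/-- Expand `v a` in the basis `J`: if every `v b` with nonzero coefficient lay in the span of `I \
{a}`, so would `v a`. -/
theorem symmetric_exchange (hI : IsColumnBasis v I) (hJ : IsColumnBasis v J) {a : ι}
    (haI : a ∈ I) (haJ : a ∉ J) :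
    ∃ b ∈ J, b ∉ I ∧ v b ∉ Submodule.span ℝ (v '' (↑(I.erase a) : Set ι)) ∧
      v a ∉ Submodule.span ℝ (v '' (↑(J.erase b) : Set ι)) := by
  by_contra! hcon
  refine hI.notMem_span_erase haI
    (span_image_le_of_forall_mem (fun b hb => ?_) (hJ.mem_span_support a))
  obtain ⟨hbJ, hb⟩ := hb
  by_contra hb'
  by_cases hbI : b ∈ I
  · exact hb' (mem_span_image (by simp [hbI, ne_of_mem_of_not_mem hbJ haJ]))
  · exact hb (hcon b hbJ hbI hb')

end IsColumnBasis

/-- A basis of maximal weight. -/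
def IsMaxBasis (v : ι → V) (w : ι → ℝ) (I : Finset ι) : Prop :=
  IsColumnBasis v I ∧ ∀ K, IsColumnBasis v K → ∑ i ∈ K, w i ≤ ∑ i ∈ I, w i

theorem exists_isMaxBasis {v : ι → V} [Fintype ι] (w : ι → ℝ) (h : ∃ I, IsColumnBasis v I) :
    ∃ I, IsMaxBasis v w I := by
  classical
  obtain ⟨I₀, h₀⟩ := h
  obtain ⟨I, hI, hmax⟩ := (Finset.univ.filter (IsColumnBasis v)).exists_max_image
    (fun I => ∑ i ∈ I, w i) ⟨I₀, by simpa using h₀⟩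
  exact ⟨I, by simpa using hI, fun K hK => hmax K (by simpa using hK)⟩

namespace IsMaxBasis

variable [DecidableEq ι] {v : ι → V} {w : ι → ℝ} {I J : Finset ι}

theorem weight_le (hI : IsMaxBasis v w I) {s l : ι} (hs : s ∈ I)
    (hl : v l ∉ Submodule.span ℝ (v '' (↑(I.erase s) : Set ι))) : w l ≤ w s := by
  by_cases hls : l = s
  · rw [hls]
  have hlI : l ∉ I.erase s := fun h => hl (mem_span_image h)
  have h := hI.2 _ (hI.1.exchange hs hl)
  rw [Finset.sum_insert hlI, ← Finset.add_sum_erase I w hs] at h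
  linarith

/-- A lighter basis element with nonzero coefficient could be exchanged for `l`, increasing the
weight. -/
theorem mem_span_ge (hI : IsMaxBasis v w I) (l : ι) :
    v l ∈ Submodule.span ℝ (v '' {s | s ∈ I ∧ w l ≤ w s}) :=
  span_image_mono (K := {s | s ∈ I ∧ w l ≤ w s})
    (fun _ hs => ⟨hs.1, hI.weight_le hs.1 hs.2⟩) (hI.1.mem_span_support l)

theorem span_gt_le_span_erase (hI : IsMaxBasis v w I) (a : ι) :
    Submodule.span ℝ (v '' {l | w a < w l}) ≤ Submodule.span ℝ (v '' (↑(I.erase a) : Set ι)) := by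
  refine span_image_le_of_forall_mem fun l hl => span_image_mono ?_ (hI.mem_span_ge l)
  rintro s ⟨hs, hls⟩
  have hl : w a < w l := hl
  have : s ≠ a := by rintro rfl; linarith
  simp [hs, this]

theorem notMem_span_gt (hI : IsMaxBasis v w I) {a : ι} (ha : a ∈ I) :
    v a ∉ Submodule.span ℝ (v '' {l | w a < w l}) :=
  fun h => hI.1.notMem_span_erase ha (hI.span_gt_le_span_erase a h)

/-- A symmetric exchange keeps both sets bases, so optimality of `I` and of `J` gives the two
opposite inequalities. -/
theorem exists_tie (hI : IsMaxBasis v w I) (hJ : IsMaxBasis v w J) {a : ι}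
    (haI : a ∈ I) (haJ : a ∉ J) : ∃ b ∈ J, b ∉ I ∧ w a = w b := by
  obtain ⟨b, hbJ, hbI, h1, h2⟩ := hI.1.symmetric_exchange hJ.1 haI haJ
  exact ⟨b, hbJ, hbI, le_antisymm (hJ.weight_le hbJ h2) (hI.weight_le haI h1)⟩

/-- Two different bases of maximal weight differ by the exchange of two elements of equal
weight, if no weight is attained three times and only one weight is attained twice. -/
theorem exists_exchange (hI : IsMaxBasis v w I) (hJ : IsMaxBasis v w J) (hIJ : I ≠ J)
    (hcard : I.card = J.card)
    (hlevel : ∀ a b c, a ≠ b → w a = w b → w c = w a → c = a ∨ c = b)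
    (hpair : 2 ≤ I.card → ∀ a b a' b', a ≠ b → a' ≠ b' → w a = w b → w a' = w b' →
      a' = a ∨ a' = b) :
    ∃ a b, a ∈ I ∧ a ∉ J ∧ b ∈ J ∧ b ∉ I ∧ w a = w b ∧ I.erase a = J.erase b ∧
      SpanExchange v {l | w a < w l} b a := by
  obtain ⟨a, haI, haJ⟩ : ∃ a ∈ I, a ∉ J := by
    by_contra! h
    exact hIJ (Finset.eq_of_subset_of_card_le h hcard.ge)
  obtain ⟨b, hbJ, hbI, hab⟩ := hI.exists_tie hJ haI haJ
  have hne : a ≠ b := ne_of_mem_of_not_mem haI hbI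
  refine ⟨a, b, haI, haJ, hbJ, hbI, hab, ?_, ?_, ?_⟩
  · refine Finset.eq_of_subset_of_card_le (fun s hs => ?_) ?_
    · obtain ⟨hsa, hsI⟩ := Finset.mem_erase.1 hs
      refine Finset.mem_erase.2 ⟨ne_of_mem_of_not_mem hsI hbI, ?_⟩
      -- A second element of `I \ J` would produce a second tied pair, which `hpair` forbids.
      by_contra hsJ
      obtain ⟨t, htJ, htI, hst⟩ := hI.exists_tie hJ hsI hsJ
      have h2 : 2 ≤ I.card := Finset.one_lt_card.2 ⟨s, hsI, a, haI, hsa⟩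
      rcases hpair h2 a b s t hne (ne_of_mem_of_not_mem hsI htI) hab hst with h | h
      · exact hsa h
      · exact hbI (h ▸ hsI)
    · rw [Finset.card_erase_of_mem haI, Finset.card_erase_of_mem hbJ, hcard]
  -- In the expansion of `v b` over `I`, the only possible index of weight exactly `w b` is `a`, as
  -- `b ∉ I`.
  · refine span_image_mono ?_ (hI.mem_span_ge b)
    rintro s ⟨hsI, hs⟩
    rcases hs.lt_or_eq with h | h
    · exact Or.inr (show w a < w s by rw [hab]; exact h)
    · rcases hlevel a b s hne hab (by rw [hab, h]) with rfl | rfl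
      · exact Or.inl rfl
      · exact absurd hsI hbI
  · rw [hab]
    exact hJ.notMem_span_gt hbJ

/-- The heavier vectors lie in the span of `I \ {a}`; if `v b` did too, the exchange relation would
put `v a` there. -/
theorem exchange_of_spanExchange (hI : IsMaxBasis v w I) {a b : ι} (ha : a ∈ I) (hne : b ≠ a)
    (hex : SpanExchange v {l | w a < w l} b a) :
    b ∉ I ∧ IsColumnBasis v (insert b (I.erase a)) := by
  have key : v b ∉ Submodule.span ℝ (v '' (↑(I.erase a) : Set ι)) := fun hb =>
    hI.1.notMem_span_erase ha (span_image_le_of_forall_mem (by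
      rintro l (rfl | hl)
      · exact hb
      · exact hI.span_gt_le_span_erase a (mem_span_image hl)) hex.symm.1)
  refine ⟨fun hb => ?_, hI.1.exchange ha key⟩
  exact key (mem_span_image (by simp [hb, hne]))

theorem mem_or_mem (hI : IsMaxBasis v w I) {a b : ι} (hab : w a = w b)
    (hlevel : ∀ c, w c = w a → c = a ∨ c = b)
    (hex : SpanExchange v {l | w a < w l} b a) : a ∈ I ∨ b ∈ I := by
  by_contra! h
  refine hex.2 (span_image_mono ?_ (hI.mem_span_ge b))
  rintro s ⟨hsI, hs⟩
  rcases hs.lt_or_eq with h' | h'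
  · exact show w a < w s by rw [hab]; exact h'
  · rcases hlevel s (by rw [hab, h']) with rfl | rfl
    · exact absurd hsI h.1
    · exact absurd hsI h.2

/-- The exchange pair `a, b` of equal weights gives exactly two bases of maximal weight. -/
theorem exists_pair [Fintype ι] {k : ℕ} {a b : ι} (hne : a ≠ b) (hab : w a = w b)
    (hbasis : ∃ I, IsColumnBasis v I) (hk : ∀ I, IsColumnBasis v I → I.card = k)
    (hlevel : ∀ a b c, a ≠ b → w a = w b → w c = w a → c = a ∨ c = b)
    (hpair : 2 ≤ k → ∀ a b a' b', a ≠ b → a' ≠ b' → w a = w b → w a' = w b' →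
      a' = a ∨ a' = b)
    (hex : SpanExchange v {l | w a < w l} b a) :
    ∃ S, a ∉ S ∧ b ∉ S ∧ IsColumnBasis v (insert a S) ∧ IsColumnBasis v (insert b S) ∧
      ∀ K, IsColumnBasis v K → K ≠ insert a S → K ≠ insert b S →
        ∑ i ∈ K, w i < ∑ i ∈ insert a S, w i := by
  obtain ⟨I, hI⟩ := exists_isMaxBasis w hbasis
  wlog haI : a ∈ I generalizing a b
  · have hbI := (hI.mem_or_mem hab (hlevel a b · hne hab) hex).resolve_left haI
    have hex' : SpanExchange v {l | w b < w l} a b := by rw [← hab]; exact hex.symm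
    obtain ⟨S, h1, h2, h3, h4, h5⟩ := this hne.symm hab.symm hex' hbI
    refine ⟨S, h2, h1, h4, h3, fun K hK hKa hKb => (h5 K hK hKb hKa).trans_eq ?_⟩
    rw [Finset.sum_insert h1, Finset.sum_insert h2, hab]
  obtain ⟨hbI, hB⟩ := hI.exchange_of_spanExchange haI hne.symm hex
  refine ⟨I.erase a, by simp, by simp [hbI], by rw [Finset.insert_erase haI]; exact hI.1, hB,
    fun K hK hKa hKb => ?_⟩
  rw [Finset.insert_erase haI] at hKa ⊢
  refine lt_of_le_of_ne (hI.2 K hK) fun heq => hKb ?_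
  have hKmax : IsMaxBasis v w K := ⟨hK, fun L hL => (hI.2 L hL).trans_eq heq.symm⟩
  obtain ⟨a', b', ha'I, -, hb'K, hb'I, hab', her, -⟩ := hI.exists_exchange hKmax hKa.symm
    ((hk I hI.1).trans (hk K hK).symm) hlevel (by rw [hk I hI.1]; exact hpair)
  have hne' : a' ≠ b' := ne_of_mem_of_not_mem ha'I hb'I
  -- If `a' ≠ a`, then `I` has two elements, so `2 ≤ k` and `hpair` applies; for `k = 1` several
  -- tied pairs may coexist, but a basis has no room for them.
  have haa : a' = a := by
    by_contra hn
    have h2 : 2 ≤ k := by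
      rw [← hk I hI.1]
      exact Finset.one_lt_card.2 ⟨a', ha'I, a, haI, hn⟩
    rcases hpair h2 a b a' b' hne hne' hab hab' with h | h
    · exact hn h
    · exact hbI (h ▸ ha'I)
  subst haa
  have hbb : b' = b := (hlevel a' b b' hne hab hab'.symm).resolve_left hne'.symm
  subst hbb
  rw [her, Finset.insert_erase hb'K]

end IsMaxBasis

end VectorConfiguration

/-! ### Cyclic intervals and shifted orders -/

section CyclicOrder

variable {n : ℕ}

/-- Removes modular subtraction, so that cyclic statements become linear arithmetic. -/
theorem shiftedLT_iff (r a b : Fin n) :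
    ShiftedLT r a b ↔ (r ≤ a ∧ a < b) ∨ (b < r ∧ r ≤ a) ∨ (a < b ∧ b < r) := by
  have hval : ∀ x : Fin n, ((x - r : Fin n) : ℕ) =
      if (r : ℕ) ≤ x then (x : ℕ) - r else n + x - r := by
    intro x
    split_ifs with h
    · exact Fin.coe_sub_iff_le.2 h
    · exact Fin.coe_sub_iff_lt.2 (not_le.1 h)
  have ha := hval a
  have hb := hval b
  have := a.2
  have := b.2
  have := r.2
  rw [ShiftedLT, Fin.lt_def, ha, hb]
  simp only [Fin.lt_def, Fin.le_def]
  split_ifs <;> omega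

theorem val_finRotate (i : Fin n) :
    ((finRotate n i : Fin n) : ℕ) = if (i : ℕ) + 1 = n then 0 else (i : ℕ) + 1 := by
  cases n with
  | zero => exact i.elim0
  | succ m =>
    split_ifs with h
    · have : i = Fin.last m := Fin.ext (by simp; omega)
      rw [this, finRotate_last]; rfl
    · exact coe_finRotate_of_ne_last fun h' => h (by rw [h']; simp)

/-- The open cyclic interval from `i` to `j`. -/
def cyclicInterval (i j : Fin n) : Set (Fin n) := {l | l ≠ i ∧ ShiftedLT i l j}

theorem mem_cyclicInterval {i j l : Fin n} :
    l ∈ cyclicInterval i j ↔ (i < l ∧ l < j) ∨ (j < i ∧ i < l) ∨ (l < j ∧ j < i) := by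
  rw [cyclicInterval, mem_ofPred_eq, shiftedLT_iff]
  simp only [Fin.lt_def, Fin.le_def, ne_eq, Fin.ext_iff]
  omega

theorem shiftedLT_finRotate {i a b : Fin n} (hb : b ≠ i) :
    ShiftedLT (finRotate n i) a b ↔ a ∈ cyclicInterval i b := by
  rw [mem_cyclicInterval, shiftedLT_iff]
  have h := val_finRotate i
  have := a.2
  have := b.2
  have := i.2
  simp only [Fin.lt_def, Fin.le_def, ne_eq, Fin.ext_iff] at *
  rw [h]
  split_ifs <;> omega

theorem shiftedLT_finRotate_self {i a : Fin n} : ShiftedLT (finRotate n i) a i ↔ a ≠ i := by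
  rw [shiftedLT_iff]
  have h := val_finRotate i
  have := a.2
  have := i.2
  simp only [Fin.lt_def, Fin.le_def, ne_eq, Fin.ext_iff] at *
  rw [h]
  split_ifs <;> omega

theorem shiftedLT_iff_mem_insert {i a b : Fin n} (hb : b ≠ i) :
    ShiftedLT i a b ↔ a ∈ insert i (cyclicInterval i b) := by
  rw [mem_insert_iff, mem_cyclicInterval, shiftedLT_iff]
  simp only [Fin.lt_def, Fin.le_def, ne_eq, Fin.ext_iff] at *
  omega

theorem cyclicInterval_trichotomy {i a b : Fin n} (ha : a ≠ i) (hb : b ≠ i) (hab : a ≠ b) :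
    a ∈ cyclicInterval i b ∨ b ∈ cyclicInterval i a := by
  simp only [mem_cyclicInterval, Fin.lt_def, ne_eq, Fin.ext_iff] at *
  omega

theorem insert_cyclicInterval_subset {i a b : Fin n} (h : a ∈ cyclicInterval i b) :
    insert a (cyclicInterval i a) ⊆ cyclicInterval i b := by
  intro l
  rw [mem_insert_iff]
  simp only [mem_cyclicInterval, Fin.lt_def, Fin.ext_iff] at *
  omega

theorem cyclicInterval_trichotomy_left {i i' b : Fin n} (hi : i ≠ b) (hi' : i' ≠ b)
    (hii : i ≠ i') : i ∈ cyclicInterval i' b ∨ i' ∈ cyclicInterval i b := by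
  simp only [mem_cyclicInterval, Fin.lt_def, ne_eq, Fin.ext_iff] at *
  omega

theorem insert_cyclicInterval_subset_left {i i' b : Fin n} (h : i' ∈ cyclicInterval i b) :
    insert i' (cyclicInterval i' b) ⊆ cyclicInterval i b := by
  intro l
  rw [mem_insert_iff]
  simp only [mem_cyclicInterval, Fin.lt_def, Fin.ext_iff] at *
  omega

end CyclicOrder

/-! ### The permutation of the Grassmann necklace -/

section NecklacePermutation

variable {n : ℕ} {V : Type*} [AddCommGroup V] [Module ℝ V] {v : Fin n → V}

/-- `v i` enters the span of `v (i + 1), v (i + 2), …` (cyclically) at the index `j ≠ i`. -/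
def NecklaceRel (v : Fin n → V) (i j : Fin n) : Prop :=
  j ≠ i ∧ SpanExchange v (cyclicInterval i j) i j

/-- Once `v i` has entered the span at the nearer index, it cannot enter at the farther one. -/
theorem NecklaceRel.right_unique {i j j' : Fin n} (h : NecklaceRel v i j)
    (h' : NecklaceRel v i j') : j = j' := by
  by_contra hne
  rcases cyclicInterval_trichotomy h.1 h'.1 hne with hm | hm
  · exact h'.2.2 (span_image_mono (insert_cyclicInterval_subset hm) h.2.1)
  · exact h.2.2 (span_image_mono (insert_cyclicInterval_subset hm) h'.2.1)

/-- By symmetry of the exchange, `v j` enters the span of its cyclic predecessors at `i`, so the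
same argument runs backwards. -/
theorem NecklaceRel.left_unique {i i' j : Fin n} (h : NecklaceRel v i j)
    (h' : NecklaceRel v i' j) : i = i' := by
  by_contra hne
  rcases cyclicInterval_trichotomy_left h.1.symm h'.1.symm hne with hm | hm
  · exact h'.2.symm.2 (span_image_mono (insert_cyclicInterval_subset_left hm) h.2.symm.1)
  · exact h.2.symm.2 (span_image_mono (insert_cyclicInterval_subset_left hm) h'.2.symm.1)

/-- The cyclically last element `j` of `T`, counted from `i`, works; `v i ≠ 0` makes `T` nonempty.
-/
theorem exists_last_of_mem_span {i : Fin n} (hv : v i ≠ 0) {T : Set (Fin n)} (hi : i ∉ T)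
    (hT : v i ∈ Submodule.span ℝ (v '' T)) :
    ∃ j ∈ T, v i ∈ Submodule.span ℝ (v '' insert j (cyclicInterval i j)) := by
  have hne : T.Nonempty := by
    by_contra h
    rw [not_nonempty_iff_eq_empty] at h
    simp [h] at hT
    exact hv hT
  obtain ⟨j, hj, hmax⟩ := T.toFinite.exists_maximalFor (fun l => l - i) T hne
  refine ⟨j, hj, span_image_mono (fun l hl => ?_) hT⟩
  by_contra hl'
  rw [mem_insert_iff, not_or] at hl'
  have hli : l ≠ i := ne_of_mem_of_not_mem hl hi
  have hji : j ≠ i := ne_of_mem_of_not_mem hj hi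
  have hlt : j - i < l - i :=
    ((cyclicInterval_trichotomy hli hji hl'.1).resolve_left hl'.2).2
  exact absurd (hmax hl hlt.le) (not_le.2 hlt)

theorem exists_necklaceRel {i : Fin n} (hv : v i ≠ 0)
    (hspan : v i ∈ Submodule.span ℝ (v '' {i}ᶜ)) : ∃ j, NecklaceRel v i j := by
  have hne : {j : Fin n | j ≠ i ∧
      v i ∈ Submodule.span ℝ (v '' insert j (cyclicInterval i j))}.Nonempty := by
    obtain ⟨j, hj, h⟩ := exists_last_of_mem_span hv (by simp) hspan
    exact ⟨j, hj, h⟩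
  obtain ⟨j, ⟨hj, hmem⟩, hmin⟩ := (Set.toFinite _).exists_minimalFor (fun l => l - i) _ hne
  refine ⟨j, hj, hmem, fun hmem' => ?_⟩
  -- If `v i` were already spanned before `j`, the last index used would be an earlier candidate.
  obtain ⟨j', hj', h⟩ := exists_last_of_mem_span hv (fun h => h.1 rfl) hmem'
  have hlt : j' - i < j - i := hj'.2
  exact absurd (hmin ⟨hj'.1, h⟩ hlt.le) (not_le.2 hlt)

/-- The permutation of the necklace, for vectors without loops and coloops. -/
theorem exists_perm_necklaceRel (hv : ∀ i, v i ≠ 0)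
    (hspan : ∀ i, v i ∈ Submodule.span ℝ (v '' {i}ᶜ)) :
    ∃ π : Equiv.Perm (Fin n), ∀ i j, π j = i ↔ NecklaceRel v i j := by
  choose f hf using fun i => exists_necklaceRel (hv i) (hspan i)
  have hinj : Function.Injective f := fun i i' h => (hf i).left_unique (h ▸ hf i')
  refine ⟨(Equiv.ofBijective f (Finite.injective_iff_bijective.1 hinj)).symm, fun i j => ?_⟩
  rw [Equiv.symm_apply_eq, Equiv.ofBijective_apply]
  exact ⟨fun h => h ▸ hf i, fun h => h.right_unique (hf i)⟩

/-- The basis selected greedily for the order starting at `r`. -/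
theorem exists_greedyBasis (hbasis : ∃ I, IsColumnBasis v I) (r : Fin n) :
    ∃ I, IsColumnBasis v I ∧
      (∀ l, l ∈ I ↔ v l ∉ Submodule.span ℝ (v '' {b | ShiftedLT r b l})) ∧
      ∀ J, IsColumnBasis v J → J ≠ I → I.card = J.card →
        ∃ a ∈ I, a ∉ J ∧ ∀ b, ShiftedLT r b a → (b ∈ I ↔ b ∈ J) := by
  -- Minus the position in the order from `r`: heavier means earlier.
  let w : Fin n → ℝ := fun l => -(((l - r : Fin n) : ℕ) : ℝ)
  have hw : ∀ a b, w a < w b ↔ ShiftedLT r b a := fun a b => by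
    simp [w, ShiftedLT]
  have hinj : ∀ a b, ¬ ShiftedLT r a b → a ≠ b → ShiftedLT r b a := fun a b h1 h2 => by
    rw [shiftedLT_iff] at *
    simp only [Fin.lt_def, Fin.le_def, ne_eq, Fin.ext_iff] at *
    omega
  obtain ⟨I, hI⟩ := exists_isMaxBasis w hbasis
  have hset : ∀ a, {l | w a < w l} = {b | ShiftedLT r b a} := fun a => by ext b; exact hw a b
  have hmem : ∀ l, l ∉ I →
      v l ∈ Submodule.span ℝ (v '' {s | s ∈ I ∧ ShiftedLT r s l}) := fun l hl => by
    refine span_image_mono ?_ (hI.mem_span_ge l)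
    rintro s ⟨hsI, hs⟩
    refine ⟨hsI, hinj _ _ (fun h => ?_) (ne_of_mem_of_not_mem hsI hl).symm⟩
    exact absurd ((hw s l).2 h) (not_lt.2 hs)
  refine ⟨I, hI.1, fun l => ⟨fun hl => ?_, fun hl => ?_⟩, fun J hJ hne hcard => ?_⟩
  · rw [← hset]
    exact hI.notMem_span_gt hl
  · by_contra hl'
    exact hl (span_image_mono (fun s hs => hs.2) (hmem l hl'))
  · have hD : {a | ¬ (a ∈ I ↔ a ∈ J)}.Nonempty := by
      by_contra h
      rw [not_nonempty_iff_eq_empty, eq_empty_iff_forall_notMem] at h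
      exact hne (Finset.ext fun a => (not_not.1 (h a)).symm)
    obtain ⟨a, ha, hmin⟩ := (Set.toFinite _).exists_minimalFor (fun l => l - r) _ hD
    have hbefore : ∀ b, ShiftedLT r b a → (b ∈ I ↔ b ∈ J) := fun b hb => by
      by_contra hb'
      exact absurd (hmin hb' (le_of_lt hb)) (not_le.2 hb)
    -- Otherwise `v a` is spanned by earlier elements of `I`, which also lie in `J`, contradicting
    -- independence of `J`.
    have haI : a ∈ I := by
      by_contra haI
      have haJ : a ∈ J := by simpa [haI] using ha
      refine hJ.notMem_span_erase haJ (span_image_mono ?_ (hmem a haI))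
      rintro s ⟨hsI, hs⟩
      have : s ≠ a := ne_of_mem_of_not_mem hsI haI
      simp [this, (hbefore s hs).1 hsI]
    exact ⟨a, haI, by simpa [haI] using ha, hbefore⟩

/-- Passing to the next order moves `i` from first to last place. There it is redundant, and an
index `a ≠ i` changes status only if dropping `v i` from its predecessors matters, that is, if `a`
is the partner of `i`. -/
theorem greedyBasis_finRotate (hspan : ∀ i, v i ∈ Submodule.span ℝ (v '' {i}ᶜ))
    {N : Fin n → Finset (Fin n)}
    (hN : ∀ r l, l ∈ N r ↔ v l ∉ Submodule.span ℝ (v '' {b | ShiftedLT r b l}))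
    {i j : Fin n} (hij : NecklaceRel v i j) :
    N (finRotate n i) = insert j ((N i).erase i) := by
  ext a
  rw [Finset.mem_insert, Finset.mem_erase, hN, hN]
  by_cases hai : a = i
  · subst hai
    have : {b | ShiftedLT (finRotate n a) b a} = {a}ᶜ := by
      ext b; exact shiftedLT_finRotate_self
    rw [this]
    simp [hspan a, hij.1.symm]
  have h1 : {b | ShiftedLT (finRotate n i) b a} = cyclicInterval i a := by
    ext b; exact shiftedLT_finRotate hai
  have h2 : {b | ShiftedLT i b a} = insert i (cyclicInterval i a) := by
    ext b; exact shiftedLT_iff_mem_insert hai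
  rw [h1, h2]
  by_cases haj : a = j
  · subst haj
    simp [hij.2.symm.2]
  · simp only [haj, false_or, hai, ne_eq, not_false_eq_true, true_and, not_iff_not]
    refine ⟨fun h => span_image_mono (subset_insert _ _) h, fun h => ?_⟩
    by_contra h'
    exact haj (NecklaceRel.right_unique ⟨hai, SpanExchange.symm ⟨h, h'⟩⟩ hij)

/-- The cyclic interval from `i` to `j` contains every index below `j` if `j < i`; if `i < j`, the
interval with `i` added lies below `j`. Thus excedances are the elements of the greedy basis for the
usual order. -/
theorem lt_iff_notMem_span {i j : Fin n} (hij : NecklaceRel v i j) :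
    j < i ↔ v j ∉ Submodule.span ℝ (v '' {b | b < j}) := by
  refine ⟨fun h hmem => hij.2.symm.2 (span_image_mono (fun l hl => ?_) hmem), fun h => ?_⟩
  · exact mem_cyclicInterval.2 (Or.inr (Or.inr ⟨hl, h⟩))
  · by_contra hlt
    have hlt' : i < j := lt_of_le_of_ne (not_lt.1 hlt) hij.1.symm
    refine h (span_image_mono (fun l hl => ?_) hij.2.symm.1)
    rw [mem_insert_iff, mem_cyclicInterval] at hl
    simp only [Fin.lt_def, Fin.ext_iff, mem_ofPred_eq] at *
    omega

/-- The number of excedances is the size of a basis. -/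
theorem card_excedances (hbasis : ∃ I, IsColumnBasis v I) {k : ℕ}
    (hk : ∀ I, IsColumnBasis v I → I.card = k) {π : Equiv.Perm (Fin n)}
    (hπ : ∀ i j, π j = i ↔ NecklaceRel v i j) :
    (Finset.univ.filter fun a => a < π a).card = k := by
  cases n with
  | zero =>
    obtain ⟨I, hI⟩ := hbasis
    rw [← hk I hI]
    simp [Finset.eq_empty_of_isEmpty]
  | succ m =>
    obtain ⟨I, hI, hg, -⟩ := exists_greedyBasis hbasis 0
    rw [← hk I hI]
    congr 1
    ext a
    rw [hg, Finset.mem_filter_univ, lt_iff_notMem_span ((hπ _ _).1 rfl)]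
    simp [ShiftedLT]

end NecklacePermutation

/-! ### Maxima of affine functions on the plane -/

section PiecewiseLinear

variable {ι : Type*}

/-- The family of affine functions `a J x + b J y + c J` on the plane. -/
def affineTerm (a b c : ι → ℝ) (J : ι) (p : ℝ × ℝ) : ℝ := a J * p.1 + b J * p.2 + c J

/-- The set where the `J`-th function is strictly larger than all the others. -/
def dominanceRegion (ℓ : ι → ℝ × ℝ → ℝ) (J : ι) : Set (ℝ × ℝ) :=
  {p | ∀ K, K ≠ J → ℓ K p < ℓ J p}

/-- The set where the `J`-th function attains the maximum. -/
def closedRegion (ℓ : ι → ℝ × ℝ → ℝ) (J : ι) : Set (ℝ × ℝ) :=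
  {p | ∀ K, ℓ K p ≤ ℓ J p}

/-- The locus where `F` is not affine-linear. -/
def nonAffineLocus (F : ℝ × ℝ → ℝ) : Set (ℝ × ℝ) :=
  {p | ¬ ∃ a b c : ℝ, ∀ᶠ q in 𝓝 p, F q = a * q.1 + b * q.2 + c}

/-- An affine function with a local minimum is constant. -/
theorem eq_zero_of_eventually_nonneg {a b c : ℝ} {p : ℝ × ℝ}
    (h : ∀ᶠ q : ℝ × ℝ in 𝓝 p, 0 ≤ a * q.1 + b * q.2 + c)
    (h0 : a * p.1 + b * p.2 + c = 0) : a = 0 ∧ b = 0 := by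
  have hline : ∀ u : ℝ × ℝ, 0 ≤ a * u.1 + b * u.2 := by
    intro u
    have ht : Tendsto (fun t : ℝ => p + t • u) (𝓝[>] 0) (𝓝 p) := by
      have : Continuous fun t : ℝ => p + t • u := by fun_prop
      have h1 := this.tendsto 0
      simp only [zero_smul, add_zero] at h1
      exact h1.mono_left nhdsWithin_le_nhds
    obtain ⟨t, ht1, ht2⟩ := ((ht.eventually h).and self_mem_nhdsWithin).exists
    have ht2 : 0 < t := ht2
    simp only [Prod.fst_add, Prod.snd_add, Prod.smul_fst, Prod.smul_snd, smul_eq_mul] at ht1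
    have : 0 ≤ t * (a * u.1 + b * u.2) := by linarith
    exact nonneg_of_mul_nonneg_right this ht2
  have h1 := hline (1, 0)
  have h2 := hline (-1, 0)
  have h3 := hline (0, 1)
  have h4 := hline (0, -1)
  simp only [mul_one, mul_zero, add_zero, zero_add, mul_neg] at h1 h2 h3 h4
  exact ⟨by linarith, by linarith⟩

theorem dominanceRegion_disjoint {ℓ : ι → ℝ × ℝ → ℝ} {I J : ι} {p : ℝ × ℝ}
    (hI : p ∈ dominanceRegion ℓ I) (hJ : p ∈ dominanceRegion ℓ J) : I = J := by
  by_contra h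
  exact lt_asymm (hI J (Ne.symm h)) (hJ I h)

theorem dominanceRegion_subset_closedRegion (ℓ : ι → ℝ × ℝ → ℝ) (J : ι) :
    dominanceRegion ℓ J ⊆ closedRegion ℓ J := by
  intro p hp K
  by_cases h : K = J
  · rw [h]
  · exact (hp K h).le

variable {a b c : ι → ℝ}

local notation "ℓ" => affineTerm a b c

theorem continuous_affineTerm (J : ι) : Continuous (ℓ J) := by
  unfold affineTerm
  fun_prop

theorem affineTerm_combo (J : ι) (p q : ℝ × ℝ) {s t : ℝ} (hst : s + t = 1) :
    ℓ J (s • p + t • q) = s * ℓ J p + t * ℓ J q := by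
  simp only [affineTerm, Prod.fst_add, Prod.snd_add, Prod.smul_fst, Prod.smul_snd, smul_eq_mul]
  linear_combination (-c J) * hst

theorem convex_dominanceRegion (J : ι) : Convex ℝ (dominanceRegion ℓ J) := by
  intro p hp q hq s t hs ht hst K hK
  rw [affineTerm_combo K p q hst, affineTerm_combo J p q hst]
  have h1 := hp K hK
  have h2 := hq K hK
  rcases hs.eq_or_lt with rfl | hs
  · have : t = 1 := by linarith
    subst this
    linarith
  · nlinarith [mul_lt_mul_of_pos_left h1 hs, mul_le_mul_of_nonneg_left h2.le ht]

theorem isClosed_closedRegion (J : ι) : IsClosed (closedRegion ℓ J) := by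
  have : closedRegion ℓ J = ⋂ K, {p | ℓ K p ≤ ℓ J p} := by
    ext p; simp [closedRegion]
  rw [this]
  exact isClosed_iInter fun K => isClosed_le (continuous_affineTerm K) (continuous_affineTerm J)

theorem closure_dominanceRegion {J : ι} (h : (dominanceRegion ℓ J).Nonempty) :
    closure (dominanceRegion ℓ J) = closedRegion ℓ J := by
  refine subset_antisymm (closure_minimal (dominanceRegion_subset_closedRegion _ J)
    (isClosed_closedRegion J)) fun q hq => ?_
  obtain ⟨p, hp⟩ := h
  have ht : Tendsto (fun t : ℝ => t • p + (1 - t) • q) (𝓝[>] 0) (𝓝 q) := by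
    have : Continuous fun t : ℝ => t • p + (1 - t) • q := by fun_prop
    have h1 := this.tendsto 0
    simp only [zero_smul, zero_add, sub_zero, one_smul] at h1
    exact h1.mono_left nhdsWithin_le_nhds
  refine mem_closure_of_tendsto ht ?_
  filter_upwards [Ioo_mem_nhdsGT (show (0 : ℝ) < 1 by norm_num)] with t ht K hK
  rw [affineTerm_combo K p q (by ring), affineTerm_combo J p q (by ring)]
  have h1 := mul_lt_mul_of_pos_left (hp K hK) ht.1
  have h2 := mul_le_mul_of_nonneg_left (hq K) (show 0 ≤ 1 - t by linarith [ht.2])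
  linarith

/-- Along an unbounded common boundary (`s = 1` at `y ≫ 0`, `s = -1` at `y ≪ 0`) the two terms
have maximal growth in some direction. -/
theorem exists_direction (ha : Function.Injective a) (s : ℝ) {I J : ι} (hIJ : I ≠ J)
    (h : ∀ᶠ r : ℝ in atTop, ∃ x : ℝ, (x, s * r) ∈ closedRegion ℓ I ∩ closedRegion ℓ J) :
    ∃ m : ℝ, a I * m + s * b I = a J * m + s * b J ∧
      ∀ K, a K * m + s * b K ≤ a I * m + s * b I := by
  have hne : a I - a J ≠ 0 := sub_ne_zero.2 (ha.ne hIJ)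
  set m : ℝ := -(s * (b I - b J)) / (a I - a J) with hm
  set d : ℝ := -(c I - c J) / (a I - a J) with hd
  have hm' : m * (a I - a J) = -(s * (b I - b J)) := by rw [hm]; field_simp
  -- The terms `I` and `J` agree at height `s * r` exactly at `x = m * r + d`; a faster-growing `K`
  -- would overtake them there for large `r`.
  have hd' : d * (a I - a J) = -(c I - c J) := by rw [hd]; field_simp
  refine ⟨m, by linarith, fun K => ?_⟩
  by_contra! hlt
  have hpos : 0 < (a K * m + s * b K) - (a I * m + s * b I) := by linarith
  have hlim := (tendsto_id.const_mul_atTop hpos).eventually_gt_atTop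
    ((a I * d + c I) - (a K * d + c K))
  obtain ⟨r, ⟨x, hxI, hxJ⟩, hr⟩ := (h.and hlim).exists
  have h1 := hxI J
  have h2 := hxJ I
  have h3 := hxI K
  simp only [affineTerm, id] at h1 h2 h3 hr
  have hx : x = m * r + d := by
    have : (x - (m * r + d)) * (a I - a J) = 0 := by
      linear_combination le_antisymm h2 h1 - r * hm' - hd'
    rcases mul_eq_zero.1 this with h | h
    · linarith
    · exact absurd h hne
  rw [hx] at h3
  linarith

variable [Finite ι]

theorem isOpen_dominanceRegion (J : ι) : IsOpen (dominanceRegion ℓ J) := by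
  have : dominanceRegion ℓ J = ⋂ K, {p | K ≠ J → ℓ K p < ℓ J p} := by
    ext p; simp [dominanceRegion]
  rw [this]
  refine isOpen_iInter_of_finite fun K => ?_
  by_cases h : K = J
  · simp [h]
  · simpa [h] using isOpen_lt (continuous_affineTerm K) (continuous_affineTerm J)

theorem iSup_eq_of_mem_closedRegion {f : ι → ℝ × ℝ → ℝ} {J : ι} {p : ℝ × ℝ}
    (h : p ∈ closedRegion f J) : ⨆ K, f K p = f J p := by
  have : Nonempty ι := ⟨J⟩
  exact le_antisymm (ciSup_le h) (le_ciSup (f := fun K => f K p) (Set.finite_range _).bddAbove J)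

/-- Where the maximum is locally affine, its difference with any term attaining it has a local
minimum, so all such terms share one `x`-slope and coincide. -/
theorem compl_nonAffineLocus [Nonempty ι] (ha : Function.Injective a) :
    (nonAffineLocus fun p => ⨆ K, ℓ K p)ᶜ = ⋃ J, dominanceRegion ℓ J := by
  ext p
  rw [mem_compl_iff, nonAffineLocus, mem_ofPred_eq, not_not, mem_iUnion]
  constructor
  · rintro ⟨α, β, γ, h⟩
    obtain ⟨J, hJ⟩ := Finite.exists_max fun K => ℓ K p
    have hp : p ∈ closedRegion ℓ J := hJ
    have hle : ∀ K, ∀ q, ℓ K q ≤ ⨆ K, ℓ K q := fun K q =>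
      le_ciSup (f := fun K => ℓ K q) (Set.finite_range _).bddAbove K
    have hpv := h.self_of_nhds
    rw [iSup_eq_of_mem_closedRegion hp] at hpv
    have hslope : ∀ K, ℓ K p = ℓ J p → a K = α := by
      intro K hK
      have := (eq_zero_of_eventually_nonneg (a := α - a K) (b := β - b K) (c := γ - c K) (p := p)
        (h.mono fun q hq => ?_) ?_).1
      · linarith
      · have := hle K q
        rw [hq] at this
        simp only [affineTerm] at this
        linarith
      · simp only [affineTerm] at hpv hK
        linarith
    refine ⟨J, fun K hK => lt_of_le_of_ne (hJ K) fun heq => hK (ha ?_)⟩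
    rw [hslope K heq, hslope J rfl]
  · rintro ⟨J, hJ⟩
    refine ⟨a J, b J, c J, ?_⟩
    filter_upwards [(isOpen_dominanceRegion J).mem_nhds hJ] with q hq
    exact iSup_eq_of_mem_closedRegion (dominanceRegion_subset_closedRegion _ J hq)

/-- The dominance regions are convex, open and pairwise disjoint. -/
theorem connectedComponentIn_compl_nonAffineLocus (ha : Function.Injective a) {J : ι} {p : ℝ × ℝ}
    (hp : p ∈ dominanceRegion ℓ J) :
    connectedComponentIn (nonAffineLocus fun p => ⨆ K, ℓ K p)ᶜ p = dominanceRegion ℓ J := by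
  have : Nonempty ι := ⟨J⟩
  rw [compl_nonAffineLocus ha]
  have hsub : dominanceRegion ℓ J ⊆ ⋃ K, dominanceRegion ℓ K := subset_iUnion _ J
  refine subset_antisymm ?_
    ((convex_dominanceRegion J).isPreconnected.subset_connectedComponentIn hp hsub)
  have hcover : connectedComponentIn (⋃ K, dominanceRegion ℓ K) p ⊆
      dominanceRegion ℓ J ∪ ⋃ K, ⋃ (_ : K ≠ J), dominanceRegion ℓ K := by
    intro q hq
    obtain ⟨K, hK⟩ := mem_iUnion.1 (connectedComponentIn_subset _ _ hq)
    by_cases h : K = J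
    · exact Or.inl (h ▸ hK)
    · exact Or.inr (mem_iUnion₂.2 ⟨K, h, hK⟩)
  refine isPreconnected_connectedComponentIn.subset_left_of_subset_union
    (isOpen_dominanceRegion J)
    (isOpen_iUnion fun K => isOpen_iUnion fun _ => isOpen_dominanceRegion K) ?_ hcover
    ⟨p, mem_connectedComponentIn (hsub hp), hp⟩
  rw [Set.disjoint_left]
  intro q hq hq'
  obtain ⟨K, hK, hqK⟩ := mem_iUnion₂.1 hq'
  exact hK (dominanceRegion_disjoint hqK hq)

/-- Two terms which alone have maximal growth in some direction are separated by an unbounded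
boundary. -/
theorem unbounded_boundary (ha : Function.Injective a) {s : ℝ} (hs : s ≠ 0) {I J : ι}
    (hIJ : I ≠ J) {m : ℝ} (heq : a I * m + s * b I = a J * m + s * b J)
    (hlt : ∀ K, K ≠ I → K ≠ J → a K * m + s * b K < a I * m + s * b I) :
    (dominanceRegion ℓ I).Nonempty ∧ (dominanceRegion ℓ J).Nonempty ∧
    (closedRegion ℓ I ∩ closedRegion ℓ J).Nontrivial ∧
    (∀ᶠ r : ℝ in atTop, ∃ x : ℝ, (x, s * r) ∈ closedRegion ℓ I ∩ closedRegion ℓ J) ∧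
    ∃ p ∈ closedRegion ℓ I ∩ closedRegion ℓ J, ∀ K, K ≠ I → K ≠ J → ℓ K p < ℓ I p := by
  have hne : a I - a J ≠ 0 := sub_ne_zero.2 (ha.ne hIJ)
  set d : ℝ := -(c I - c J) / (a I - a J) with hd
  have hd' : d * (a I - a J) = -(c I - c J) := by rw [hd]; field_simp
  have hval : ∀ r, ℓ I (m * r + d, s * r) = ℓ J (m * r + d, s * r) := fun r => by
    simp only [affineTerm]
    linear_combination r * heq + hd'
  have hdom : ∀ᶠ r : ℝ in atTop, ∀ K, K ≠ I → K ≠ J →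
      ℓ K (m * r + d, s * r) < ℓ I (m * r + d, s * r) := by
    refine eventually_all.2 fun K => ?_
    by_cases hK : K ≠ I ∧ K ≠ J
    · have hpos : 0 < (a I * m + s * b I) - (a K * m + s * b K) := by
        linarith [hlt K hK.1 hK.2]
      filter_upwards [(tendsto_id.const_mul_atTop hpos).eventually_gt_atTop
        ((a K * d + c K) - (a I * d + c I))] with r hr _ _
      simp only [affineTerm, id] at hr ⊢
      linarith
    · exact Eventually.of_forall fun r h1 h2 => absurd ⟨h1, h2⟩ hK
  have hmem : ∀ p : ℝ × ℝ, ℓ I p = ℓ J p → (∀ K, K ≠ I → K ≠ J → ℓ K p < ℓ I p) →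
      p ∈ closedRegion ℓ I ∩ closedRegion ℓ J := by
    intro p hp hK
    have : p ∈ closedRegion ℓ I := fun K => by
      by_cases h1 : K = I
      · rw [h1]
      by_cases h2 : K = J
      · rw [h2, hp]
      exact (hK K h1 h2).le
    exact ⟨this, fun K => (this K).trans_eq hp⟩
  have hopen : ∀ p : ℝ × ℝ, (∀ K, K ≠ I → K ≠ J → ℓ K p < ℓ I p) →
      ∀ᶠ q in 𝓝 p, ∀ K, K ≠ I → K ≠ J → ℓ K q < ℓ I q := by
    intro p hp
    refine eventually_all.2 fun K => ?_
    by_cases hK : K ≠ I ∧ K ≠ J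
    · filter_upwards [(isOpen_lt (continuous_affineTerm K) (continuous_affineTerm I)).mem_nhds
        (hp K hK.1 hK.2)] with q hq _ _ using hq
    · exact Eventually.of_forall fun r h1 h2 => absurd ⟨h1, h2⟩ hK
  -- The parameters `r` and `r + 1` give two points of the boundary, making it nontrivial.
  obtain ⟨r, hr, hr1⟩ := (hdom.and (hdom.and
    (tendsto_atTop_add_const_right atTop 1 tendsto_id |>.eventually hdom))).exists
  set p : ℝ × ℝ := (m * r + d, s * r) with hp
  have hside : ∀ u : ℝ, ∀ᶠ t : ℝ in 𝓝[>] 0, ∀ K, K ≠ I → K ≠ J →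
      ℓ K (p + t • (u, 0)) < ℓ I (p + t • (u, 0)) := by
    intro u
    have hcont : Continuous fun t : ℝ => p + t • ((u, 0) : ℝ × ℝ) := by fun_prop
    have h1 := hcont.tendsto 0
    simp only [zero_smul, add_zero] at h1
    exact (h1.mono_left nhdsWithin_le_nhds).eventually (hopen p hr)
  have hdiff : ∀ u t : ℝ, ℓ I (p + t • (u, 0)) - ℓ J (p + t • (u, 0)) = t * (u * (a I - a J)) := by
    intro u t
    have := hval r
    simp only [affineTerm, hp, Prod.fst_add, Prod.snd_add, Prod.smul_fst, Prod.smul_snd,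
      smul_eq_mul] at this ⊢
    linear_combination this
  have hsq : 0 < (a I - a J) * (a I - a J) := mul_self_pos.2 hne
  refine ⟨?_, ?_, ?_, ?_, p, hmem p (hval r) hr, hr⟩
  -- A small horizontal move whose sign is that of `a I - a J` breaks the tie in favour of `I`; the
  -- opposite move favours `J`.
  · obtain ⟨t, ht, ht0⟩ := ((hside (a I - a J)).and self_mem_nhdsWithin).exists
    have hgt := mul_pos (show (0 : ℝ) < t from ht0) hsq
    have := hdiff (a I - a J) t
    refine ⟨p + t • (a I - a J, 0), fun K hK => ?_⟩
    by_cases hKJ : K = J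
    · rw [hKJ]; linarith
    · exact ht K hK hKJ
  · obtain ⟨t, ht, ht0⟩ := ((hside (-(a I - a J))).and self_mem_nhdsWithin).exists
    have hgt := mul_pos (show (0 : ℝ) < t from ht0) hsq
    have := hdiff (-(a I - a J)) t
    have hIJ' : ℓ I (p + t • (-(a I - a J), 0)) < ℓ J (p + t • (-(a I - a J), 0)) := by
      linarith
    refine ⟨p + t • (-(a I - a J), 0), fun K hK => ?_⟩
    by_cases hKI : K = I
    · rw [hKI]; exact hIJ'
    · exact (ht K hKI hK).trans hIJ'
  · refine ⟨p, hmem p (hval r) hr, _, hmem _ (hval (r + 1)) hr1.2, fun h => hs ?_⟩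
    have := congrArg Prod.snd h
    simp only [hp] at this
    linarith
  · filter_upwards [hdom] with r hr
    exact ⟨_, hmem _ (hval r) hr⟩

end PiecewiseLinear

/-! ### Columns of the matrix; irreducibility as absence of loops and coloops -/

section Columns

variable {k n : ℕ} {A : Matrix (Fin k) (Fin n) ℝ}

theorem minor_ne_zero_iff (I : KSubset k n) : minor A I ≠ 0 ↔ IsColumnBasis A.col I.1 := by
  have hrange : Set.range (I.1.orderEmbOfFin I.2) = (I.1 : Set (Fin n)) := by simp
  have hcols : (A.submatrix id (I.1.orderEmbOfFin I.2)).col = A.col ∘ I.1.orderEmbOfFin I.2 := rfl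
  have hli : minor A I ≠ 0 ↔ LinearIndependent ℝ (A.col ∘ I.1.orderEmbOfFin I.2) := by
    rw [← hcols, Matrix.linearIndependent_cols_iff_isUnit, Matrix.isUnit_iff_isUnit_det,
      isUnit_iff_ne_zero, minor]
  rw [hli, IsColumnBasis, ← hrange,
    linearIndepOn_range_iff (I.1.orderEmbOfFin I.2).injective]
  refine ⟨fun h => ⟨h, ?_⟩, fun h => h.1⟩
  rw [← range_comp]
  exact (h.span_eq_top_of_card_eq_finrank' (by simp)).ge

theorem IsColumnBasis.card_eq {I : Finset (Fin n)} (hI : IsColumnBasis A.col I) : I.card = k := by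
  have h := Module.finrank_eq_card_basis (Module.Basis.mk (v := fun i : (I : Set (Fin n)) => A.col i)
    hI.1 (by rw [← image_eq_range]; exact hI.2))
  simpa using h.symm

theorem exists_isColumnBasis (hA : A.rank = k) : ∃ I, IsColumnBasis A.col I := by
  have htop : Submodule.span ℝ (Set.range A.col) = ⊤ := by
    apply Submodule.eq_top_of_finrank_eq
    rw [← Matrix.rank_eq_finrank_span_cols, hA]
    simp
  obtain ⟨b, -, -, hb, hli⟩ := exists_linearIndepOn_extension (K := ℝ) (v := A.col)
    (linearIndepOn_empty ℝ A.col) (subset_univ ∅)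
  refine ⟨b.toFinite.toFinset, by simpa using hli, ?_⟩
  rw [← htop, Submodule.span_le, Finite.coe_toFinset, ← image_univ]
  exact hb

variable {M : Set (KSubset k n)}

theorem IsIrreducibleCell.col_ne_zero (hM : IsIrreducibleCell M) (hA : A ∈ positroidCell M)
    (i : Fin n) : A.col i ≠ 0 := by
  obtain ⟨E, p, -, ⟨g, -, rfl⟩, hcol, -⟩ := hM A hA
  obtain ⟨r, hr⟩ := hcol i
  intro h
  refine hr ?_
  rw [Matrix.mul_apply]
  exact Finset.sum_eq_zero fun s _ => by
    have : A s i = 0 := congrFun h s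
    rw [this, mul_zero]

theorem IsRREF.col_mem_span {E : Matrix (Fin k) (Fin n) ℝ} {p : Fin k → Fin n} (hE : IsRREF E p)
    (hrow : ∀ r, ∃ c, c ≠ p r ∧ E r c ≠ 0) (i : Fin n) :
    E.col i ∈ Submodule.span ℝ (E.col '' {i}ᶜ) := by
  have hcol : ∀ c, E.col c = ∑ r, E r c • E.col (p r) := by
    intro c
    ext s
    rw [Finset.sum_apply, Finset.sum_eq_single s]
    · simp [Matrix.col_apply, hE.pivot_one]
    · intro r _ hrs
      simp [Matrix.col_apply, hE.pivot_column r s hrs.symm]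
    · simp
  by_cases hi : ∃ r, p r = i
  · obtain ⟨r, rfl⟩ := hi
    obtain ⟨c, hc, hrc⟩ := hrow r
    have h1 := hcol c
    -- The extra nonzero entry in row `r` lets column `c` be solved for the pivot column of that
    -- row.
    rw [← Finset.add_sum_erase _ _ (Finset.mem_univ r)] at h1
    have h2 : E r c • E.col (p r) ∈ Submodule.span ℝ (E.col '' {p r}ᶜ) := by
      rw [eq_sub_of_add_eq h1.symm]
      refine Submodule.sub_mem _ (mem_span_image hc) (Submodule.sum_mem _ fun s hs => ?_)
      exact Submodule.smul_mem _ _ (mem_span_image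
        (hE.pivot_strictMono.injective.ne (Finset.ne_of_mem_erase hs)))
    exact (Submodule.smul_mem_iff _ hrc).1 h2
  · rw [hcol i]
    exact Submodule.sum_mem _ fun r _ =>
      Submodule.smul_mem _ _ (mem_span_image fun h => hi ⟨r, h⟩)

theorem IsIrreducibleCell.col_mem_span (hM : IsIrreducibleCell M) (hA : A ∈ positroidCell M)
    (i : Fin n) : A.col i ∈ Submodule.span ℝ (A.col '' {i}ᶜ) := by
  obtain ⟨E, p, hE, ⟨g, hg, hgE⟩, -, hrow⟩ := hM A hA
  have h := Submodule.mem_map_of_mem (f := g⁻¹.mulVecLin) (hE.col_mem_span hrow i)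
  have hcol : ∀ l, g⁻¹.mulVecLin (E.col l) = A.col l := by
    intro l
    have : g⁻¹ * E = A := by rw [hgE, Matrix.nonsing_inv_mul_cancel_left _ _ hg]
    rw [← this]
    rfl
  rw [Submodule.map_span, ← image_comp] at h
  simpa only [Function.comp_def, hcol] using h

end Columns

/-! ### Regions and borders of the contour plot -/

section Regions

variable {k n : ℕ} (κ : Fin n → ℝ) (A : Matrix (Fin k) (Fin n) ℝ) (t : ℝ)

/-- The index sets of the terms of the `τ`-function. -/
abbrev TermIndex : Type := {J : KSubset k n // minor A J ≠ 0}

/-- The logarithms of the terms of the `τ`-function. -/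
noncomputable def termLog (J : TermIndex A) (p : ℝ × ℝ) : ℝ := logTerm κ A t J.1 p

theorem termLog_eq_affineTerm :
    termLog κ A t = affineTerm (fun J => ∑ i ∈ J.1.1, κ i) (fun J => ∑ i ∈ J.1.1, κ i ^ 2)
      (fun J => Real.log (minor A J.1 * vandermondeFactor κ J.1) + ∑ i ∈ J.1.1, κ i ^ 3 * t) := by
  ext J p
  simp only [termLog, logTerm, affineTerm, Finset.sum_add_distrib, Finset.sum_mul]
  ring

variable {κ} {A} {t}

/-- Genericity for `d = k` gives this when `k ≥ 2`; smaller `k` needs only injectivity of `κ`. In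
consequence no boundary is horizontal. -/
theorem slope_injective (hκ : StrictMono κ) (hgen : IsGeneric k κ) :
    Function.Injective fun J : TermIndex A => ∑ i ∈ J.1.1, κ i := by
  intro I J h
  have hI := I.1.2
  have hJ := J.1.2
  refine Subtype.ext (Subtype.ext ?_)
  by_cases h2 : 2 ≤ k
  · exact hgen _ _ (hI.trans hJ.symm) (by omega) (by omega) h
  · have : k = 0 ∨ k = 1 := by omega
    rcases this with h0 | h1
    · rw [Finset.card_eq_zero.1 (hI.trans h0), Finset.card_eq_zero.1 (hJ.trans h0)]
    · obtain ⟨x, hx⟩ := Finset.card_eq_one.1 (hI.trans h1)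
      obtain ⟨y, hy⟩ := Finset.card_eq_one.1 (hJ.trans h1)
      simp only [hx, hy, Finset.sum_singleton] at h
      rw [hx, hy, hκ.injective h]

theorem isRegion_iff [Nonempty (TermIndex A)] (hκ : StrictMono κ) (hgen : IsGeneric k κ)
    {U : Set (ℝ × ℝ)} :
    IsRegion κ A t U ↔ ∃ J, (dominanceRegion (termLog κ A t) J).Nonempty ∧
      U = dominanceRegion (termLog κ A t) J := by
  have hinj := slope_injective (A := A) hκ hgen
  have hplot : contourPlot κ A t = nonAffineLocus fun p => ⨆ J, termLog κ A t J p := rfl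
  rw [IsRegion, hplot, termLog_eq_affineTerm]
  constructor
  · rintro ⟨p, hp, rfl⟩
    have hp' := hp
    rw [compl_nonAffineLocus hinj] at hp'
    obtain ⟨J, hJ⟩ := mem_iUnion.1 hp'
    exact ⟨J, ⟨p, hJ⟩, connectedComponentIn_compl_nonAffineLocus hinj hJ⟩
  · rintro ⟨J, ⟨p, hp⟩, rfl⟩
    refine ⟨p, ?_, (connectedComponentIn_compl_nonAffineLocus hinj hp).symm⟩
    rw [compl_nonAffineLocus hinj]
    exact mem_iUnion.2 ⟨J, hp⟩

theorem isBorder_iff [Nonempty (TermIndex A)] (hκ : StrictMono κ) (hgen : IsGeneric k κ)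
    {U V L : Set (ℝ × ℝ)} :
    IsBorder κ A t U V L ↔ ∃ I J, I ≠ J ∧
      (dominanceRegion (termLog κ A t) I).Nonempty ∧ U = dominanceRegion (termLog κ A t) I ∧
      (dominanceRegion (termLog κ A t) J).Nonempty ∧ V = dominanceRegion (termLog κ A t) J ∧
      L = closedRegion (termLog κ A t) I ∩ closedRegion (termLog κ A t) J ∧ L.Nontrivial := by
  have hclosure : ∀ J, (dominanceRegion (termLog κ A t) J).Nonempty →
      closure (dominanceRegion (termLog κ A t) J) = closedRegion (termLog κ A t) J := by
    rw [termLog_eq_affineTerm]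
    exact fun J => closure_dominanceRegion
  rw [IsBorder, isRegion_iff hκ hgen, isRegion_iff hκ hgen]
  constructor
  · rintro ⟨⟨I, hI, rfl⟩, ⟨J, hJ, rfl⟩, hne, hL, hnt⟩
    exact ⟨I, J, fun h => hne (by rw [h]), hI, rfl, hJ, rfl, by
      rw [hL, hclosure I hI, hclosure J hJ], hnt⟩
  · rintro ⟨I, J, hne, hI, rfl, hJ, rfl, hL, hnt⟩
    refine ⟨⟨I, hI, rfl⟩, ⟨J, hJ, rfl⟩, fun h => hne ?_, by
      rw [hL, hclosure I hI, hclosure J hJ], hnt⟩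
    obtain ⟨p, hp⟩ := hI
    exact dominanceRegion_disjoint hp (h ▸ hp)

theorem isDominantOn_dominanceRegion (J : TermIndex A) :
    IsDominantOn κ A t J.1 (dominanceRegion (termLog κ A t) J) :=
  ⟨J.2, fun _ hp => iSup_eq_of_mem_closedRegion (f := termLog κ A t)
    (dominanceRegion_subset_closedRegion _ J hp)⟩

/-- The line-solitons which are unbounded at `y ≫ 0` (`s = 1`) or `y ≪ 0` (`s = -1`). -/
def unboundedSolitons (κ : Fin n → ℝ) (A : Matrix (Fin k) (Fin n) ℝ) (t s : ℝ) :
    Set (Set (ℝ × ℝ)) :=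
  {L | IsLineSoliton κ A t L ∧ ∀ᶠ r : ℝ in atTop, ∃ x : ℝ, (x, s * r) ∈ L}

theorem unboundedSolitons_one : unboundedSolitons κ A t 1 = upperSolitons κ A t := by
  simp [unboundedSolitons, upperSolitons]

theorem unboundedSolitons_neg_one : unboundedSolitons κ A t (-1) = lowerSolitons κ A t := by
  ext L
  rw [unboundedSolitons, lowerSolitons, mem_ofPred_eq, mem_ofPred_eq]
  refine and_congr_right fun _ => ⟨fun h => ?_, fun h => ?_⟩
  · simpa using tendsto_neg_atBot_atTop.eventually h
  · simpa using tendsto_neg_atTop_atBot.eventually h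

end Regions

/-! ### Unbounded line-solitons and exchange pairs -/

section Solitons

variable {k n : ℕ} {κ : Fin n → ℝ} {A : Matrix (Fin k) (Fin n) ℝ} {t s : ℝ}

/-- The growth rate of the exponential with index `l` in the direction `(m, s)`. -/
def growthRate (κ : Fin n → ℝ) (s m : ℝ) (l : Fin n) : ℝ := κ l * m + s * κ l ^ 2

theorem growthRate_sub (a l : Fin n) (m : ℝ) :
    growthRate κ s m l - growthRate κ s m a = (κ l - κ a) * (m + s * (κ l + κ a)) := by
  unfold growthRate
  ring

theorem growthRate_eq_iff (hκ : StrictMono κ) {a b : Fin n} (hab : a ≠ b) {m : ℝ} :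
    growthRate κ s m a = growthRate κ s m b ↔ m = -s * (κ a + κ b) := by
  have hne : κ a - κ b ≠ 0 := sub_ne_zero.2 (hκ.injective.ne hab)
  rw [← sub_eq_zero, growthRate_sub, mul_eq_zero, or_iff_right hne]
  constructor <;> intro h <;> linarith

/-- For `s ≠ 0` the growth rate is quadratic in `κ l`, so it takes each value at most twice. -/
theorem growthRate_level (hκ : StrictMono κ) (hs : s ≠ 0) {m : ℝ} (a b c : Fin n) (hab : a ≠ b)
    (h : growthRate κ s m a = growthRate κ s m b) (hc : growthRate κ s m c = growthRate κ s m a) :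
    c = a ∨ c = b := by
  by_contra! hne
  have h1 := (growthRate_eq_iff hκ hab).1 h
  have h2 := (growthRate_eq_iff hκ hne.1).1 hc
  have h3 := mul_left_cancel₀ (neg_ne_zero.2 hs) (h1.symm.trans h2)
  exact hne.2 (hκ.injective (by linarith))

/-- A tie determines the sum of its two parameters, and by genericity for `d = 2` this sum
determines the pair. -/
theorem growthRate_pair (hκ : StrictMono κ) (hgen : IsGeneric k κ) (hs : s ≠ 0) {m : ℝ}
    (hk : 2 ≤ k) (a b a' b' : Fin n) (hab : a ≠ b) (hab' : a' ≠ b')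
    (h : growthRate κ s m a = growthRate κ s m b)
    (h' : growthRate κ s m a' = growthRate κ s m b') : a' = a ∨ a' = b := by
  have h1 := (growthRate_eq_iff hκ hab).1 h
  have h2 := (growthRate_eq_iff hκ hab').1 h'
  have h3 := mul_left_cancel₀ (neg_ne_zero.2 hs) (h1.symm.trans h2)
  have h4 : ({a, b} : Finset (Fin n)) = {a', b'} := hgen _ _
    (by rw [Finset.card_pair hab, Finset.card_pair hab']) (Finset.card_pair hab).ge
    ((Finset.card_pair hab).trans_le hk)
    (by rw [Finset.sum_pair hab, Finset.sum_pair hab', h3])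
  have h5 : a' ∈ ({a, b} : Finset (Fin n)) := by rw [h4]; simp
  simpa using h5

/-- The pairs `[a, b]` of unbounded line-solitons: `v a` and `v b` agree up to scaling modulo
the vectors of larger growth rate. -/
def IsSolitonPair (κ : Fin n → ℝ) (A : Matrix (Fin k) (Fin n) ℝ) (s : ℝ) (a b : Fin n) : Prop :=
  a < b ∧ SpanExchange A.col {l | 0 < s * ((κ l - κ a) * (κ l - κ b))} a b

theorem setOf_growthRate_lt (a b : Fin n) :
    {l | growthRate κ s (-s * (κ a + κ b)) a < growthRate κ s (-s * (κ a + κ b)) l} =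
      {l | 0 < s * ((κ l - κ a) * (κ l - κ b))} := by
  ext l
  rw [mem_ofPred_eq, mem_ofPred_eq, ← sub_pos, growthRate_sub]
  ring_nf

theorem sum_growthRate (m : ℝ) (K : Finset (Fin n)) :
    ∑ i ∈ K, growthRate κ s m i = (∑ i ∈ K, κ i) * m + s * ∑ i ∈ K, κ i ^ 2 := by
  simp only [growthRate, Finset.sum_add_distrib, Finset.sum_mul, Finset.mul_sum]

/-- `L` is the common boundary of the regions of `I = S ∪ {a}` and `J = S ∪ {b}`, the only terms
of maximal growth in the direction along which the indices `a` and `b` grow equally. -/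
def IsSolitonOfPair (κ : Fin n → ℝ) (A : Matrix (Fin k) (Fin n) ℝ) (t s : ℝ) (a b : Fin n)
    (L : Set (ℝ × ℝ)) : Prop :=
  ∃ (I J : TermIndex A) (S : Finset (Fin n)), a ∉ S ∧ b ∉ S ∧ I.1.1 = insert a S ∧
    J.1.1 = insert b S ∧ L = closedRegion (termLog κ A t) I ∩ closedRegion (termLog κ A t) J ∧
    ∀ K : TermIndex A, K ≠ I → K ≠ J →
      ∑ i ∈ K.1.1, growthRate κ s (-s * (κ a + κ b)) i <
        ∑ i ∈ I.1.1, growthRate κ s (-s * (κ a + κ b)) i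

theorem TermIndex.isColumnBasis (J : TermIndex A) : IsColumnBasis A.col J.1.1 :=
  (minor_ne_zero_iff J.1).1 J.2

/-- The term whose index set is a given column basis. -/
def TermIndex.ofBasis {I : Finset (Fin n)} (h : IsColumnBasis A.col I) : TermIndex A :=
  ⟨⟨I, h.card_eq⟩, (minor_ne_zero_iff _).2 h⟩

theorem TermIndex.ext {I J : TermIndex A} (h : I.1.1 = J.1.1) : I = J :=
  Subtype.ext (Subtype.ext h)

theorem IsSolitonPair.exists_soliton (hκ : StrictMono κ) (hgen : IsGeneric k κ) (hs : s ≠ 0)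
    (hbasis : ∃ I, IsColumnBasis A.col I) (t : ℝ) {a b : Fin n} (h : IsSolitonPair κ A s a b) :
    ∃ L, IsSolitonOfPair κ A t s a b L := by
  have hne : a ≠ b := h.1.ne
  obtain ⟨S, ha, hb, hI, hJ, hmax⟩ := IsMaxBasis.exists_pair (v := A.col)
    (w := growthRate κ s (-s * (κ a + κ b))) hne ((growthRate_eq_iff hκ hne).2 rfl) hbasis
    (fun I hI => hI.card_eq) (growthRate_level hκ hs) (growthRate_pair hκ hgen hs)
    (by rw [setOf_growthRate_lt]; exact h.2.symm)
  refine ⟨_, TermIndex.ofBasis hI, TermIndex.ofBasis hJ, S, ha, hb, rfl, rfl, rfl,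
    fun K hKI hKJ => hmax _ K.isColumnBasis (fun h => hKI (TermIndex.ext h))
      (fun h => hKJ (TermIndex.ext h))⟩

theorem IsSolitonOfPair.spec (hκ : StrictMono κ) (hgen : IsGeneric k κ) (hs : s ≠ 0)
    {a b : Fin n} (hab : a < b) {L : Set (ℝ × ℝ)} (h : IsSolitonOfPair κ A t s a b L) :
    L ∈ unboundedSolitons κ A t s ∧ HasType κ A t L a b ∧
    ∃ (I J : TermIndex A) (S : Finset (Fin n)), a ∉ S ∧ b ∉ S ∧ I.1.1 = insert a S ∧
      J.1.1 = insert b S ∧ ∃ p ∈ L, ∀ K, K ≠ I → K ≠ J → termLog κ A t K p < termLog κ A t I p := by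
  obtain ⟨I, J, S, ha, hb, hI, hJ, rfl, hmax⟩ := h
  have hIJ : I ≠ J := by
    rintro rfl
    have : a ∈ insert b S := by rw [← hJ, hI]; simp
    simp [ha, hab.ne] at this
  have heq : ∑ i ∈ I.1.1, growthRate κ s (-s * (κ a + κ b)) i =
      ∑ i ∈ J.1.1, growthRate κ s (-s * (κ a + κ b)) i := by
    rw [hI, hJ, Finset.sum_insert ha, Finset.sum_insert hb, (growthRate_eq_iff hκ hab.ne).2 rfl]
  simp only [sum_growthRate] at heq hmax
  have hub := unbounded_boundary
    (c := fun J => Real.log (minor A J.1 * vandermondeFactor κ J.1) + ∑ i ∈ J.1.1, κ i ^ 3 * t)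
    (slope_injective (A := A) hκ hgen) hs hIJ heq hmax
  rw [← termLog_eq_affineTerm] at hub
  obtain ⟨hnI, hnJ, hnt, hev, p, hp, hpK⟩ := hub
  have : Nonempty (TermIndex A) := ⟨I⟩
  have hborder : IsBorder κ A t (dominanceRegion (termLog κ A t) I)
      (dominanceRegion (termLog κ A t) J)
      (closedRegion (termLog κ A t) I ∩ closedRegion (termLog κ A t) J) :=
    (isBorder_iff hκ hgen).2 ⟨I, J, hIJ, hnI, rfl, hnJ, rfl, rfl, hnt⟩
  exact ⟨⟨⟨_, _, hborder⟩, hev⟩,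
    ⟨hab, _, _, I.1, J.1, S, hborder, isDominantOn_dominanceRegion I,
      isDominantOn_dominanceRegion J, ha, hb, hI, hJ⟩,
    I, J, S, ha, hb, hI, hJ, p, hp, hpK⟩

/-- Both solitons use the same direction; different terms containing `a` would each strictly outgrow
the other. -/
theorem IsSolitonOfPair.right_unique {a b : Fin n} (hab : a < b) {L L' : Set (ℝ × ℝ)}
    (h : IsSolitonOfPair κ A t s a b L) (h' : IsSolitonOfPair κ A t s a b L') : L = L' := by
  obtain ⟨I, J, S, ha, hb, hI, hJ, rfl, hmax⟩ := h
  obtain ⟨I', J', S', ha', hb', hI', hJ', rfl, hmax'⟩ := h'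
  have hII : I' = I := by
    by_contra hne
    have h1 : I' ≠ J := by
      rintro rfl
      have : a ∈ insert b S := by rw [← hJ, hI']; simp
      simp [ha, hab.ne] at this
    have h2 : I ≠ J' := by
      rintro rfl
      have : a ∈ insert b S' := by rw [← hJ', hI]; simp
      simp [ha', hab.ne] at this
    exact lt_asymm (hmax I' hne h1) (hmax' I (Ne.symm hne) h2)
  have hSS : S' = S := by
    rw [← Finset.erase_insert ha, ← Finset.erase_insert ha', ← hI, ← hI', hII]
  have hJJ : J' = J := TermIndex.ext (by rw [hJ, hJ', hSS])
  rw [hII, hJJ]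

/-- Some point of `L` has only `I` and `J` dominant, so `L` determines these two terms and hence
their exchanged indices; `a < b` fixes the order. -/
theorem IsSolitonOfPair.left_unique (hκ : StrictMono κ) (hgen : IsGeneric k κ) (hs : s ≠ 0)
    {a b a' b' : Fin n} (hab : a < b) (hab' : a' < b') {L : Set (ℝ × ℝ)}
    (h : IsSolitonOfPair κ A t s a b L) (h' : IsSolitonOfPair κ A t s a' b' L) :
    a = a' ∧ b = b' := by
  obtain ⟨-, -, I, J, S, ha, hb, hI, hJ, p, hpL, hp⟩ := h.spec hκ hgen hs hab
  obtain ⟨I', J', S', ha', hb', hI', hJ', rfl, -⟩ := h'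
  have hdom : ∀ K, p ∈ closedRegion (termLog κ A t) K → K = I ∨ K = J := by
    intro K hK
    by_contra! hne
    exact absurd (hK I) (not_le.2 (hp K hne.1 hne.2))
  have hout : ∀ {x y : Fin n} {T : Finset (Fin n)}, x < y → x ∉ T → x ∉ insert y T :=
    fun hxy hT => by simp [hxy.ne, hT]
  have hout' : ∀ {x y : Fin n} {T : Finset (Fin n)}, x < y → y ∉ T → y ∉ insert x T :=
    fun hxy hT => by simp [hxy.ne', hT]
  have haI : ∀ x, x ∈ I.1.1 → x ∉ J.1.1 → x = a := fun x h1 h2 => by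
    rw [hI, Finset.mem_insert] at h1
    exact h1.resolve_right fun h => h2 (by simp [hJ, h])
  have hbJ : ∀ x, x ∈ J.1.1 → x ∉ I.1.1 → x = b := fun x h1 h2 => by
    rw [hJ, Finset.mem_insert] at h1
    exact h1.resolve_right fun h => h2 (by simp [hI, h])
  have e1 : a' ∈ I'.1.1 := by simp [hI']
  have e2 : b' ∈ J'.1.1 := by simp [hJ']
  have e3 : a' ∉ J'.1.1 := by rw [hJ']; exact hout hab' ha'
  have e4 : b' ∉ I'.1.1 := by rw [hI']; exact hout' hab' hb'
  rcases hdom I' hpL.1 with rfl | rfl <;> rcases hdom J' hpL.2 with rfl | rfl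
  · exact absurd e1 e3
  · exact ⟨(haI a' e1 e3).symm, (hbJ b' e2 e4).symm⟩
  · have h1 := hbJ a' e1 e3
    have h2 := haI b' e2 e4
    rw [h1, h2] at hab'
    exact absurd hab' hab.not_gt
  · exact absurd e1 e3

theorem exists_pair_of_mem_unboundedSolitons (hκ : StrictMono κ) (hgen : IsGeneric k κ)
    (hs : s ≠ 0) (hbasis : ∃ I, IsColumnBasis A.col I) {L : Set (ℝ × ℝ)}
    (hL : L ∈ unboundedSolitons κ A t s) :
    ∃ a b, IsSolitonPair κ A s a b ∧ IsSolitonOfPair κ A t s a b L := by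
  obtain ⟨⟨U, V, hUV⟩, hev⟩ := hL
  have : Nonempty (TermIndex A) := hbasis.elim fun I hI => ⟨TermIndex.ofBasis hI⟩
  obtain ⟨I, J, hIJ, -, -, -, -, rfl, -⟩ := (isBorder_iff hκ hgen).1 hUV
  have hdir := hev
  rw [termLog_eq_affineTerm] at hdir
  obtain ⟨m, heq, hmax⟩ := exists_direction (slope_injective (A := A) hκ hgen) s hIJ hdir
  simp only [← sum_growthRate] at heq hmax
  have hI : IsMaxBasis A.col (growthRate κ s m) I.1.1 :=
    ⟨I.isColumnBasis, fun K hK => hmax (TermIndex.ofBasis hK)⟩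
  have hJ : IsMaxBasis A.col (growthRate κ s m) J.1.1 :=
    ⟨J.isColumnBasis, fun K hK => heq ▸ hmax (TermIndex.ofBasis hK)⟩
  obtain ⟨a, b, hpair, rfl⟩ : ∃ a b, IsSolitonPair κ A s a b ∧ m = -s * (κ a + κ b) := by
    obtain ⟨a, b, haI, -, -, hbI, hab, -, hex⟩ := hI.exists_exchange hJ
      (fun h => hIJ (TermIndex.ext h)) (I.1.2.trans J.1.2.symm) (growthRate_level hκ hs)
      (by rw [I.1.2]; exact growthRate_pair hκ hgen hs)
    have hne : a ≠ b := ne_of_mem_of_not_mem haI hbI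
    obtain rfl : m = -s * (κ a + κ b) := (growthRate_eq_iff hκ hne).1 hab
    rw [setOf_growthRate_lt] at hex
    rcases hne.lt_or_gt with hlt | hlt
    · exact ⟨a, b, ⟨hlt, hex.symm⟩, rfl⟩
    · refine ⟨b, a, ⟨hlt, ?_⟩, by rw [add_comm]⟩
      simpa only [mul_comm (κ _ - κ a)] using hex
  refine ⟨a, b, hpair, ?_⟩
  -- The soliton built from the pair has the only two terms of maximal growth in this direction, so
  -- these are `I` and `J`.
  obtain ⟨L, hL⟩ := hpair.exists_soliton hκ hgen hs hbasis t
  have hL' := hL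
  obtain ⟨I', J', S, -, -, -, -, rfl, hlt⟩ := hL
  have hI' : I = I' ∨ I = J' := by
    by_contra! hne
    exact absurd (hmax I') (not_le.2 (hlt I hne.1 hne.2))
  have hJ' : J = I' ∨ J = J' := by
    by_contra! hne
    exact absurd ((hmax I').trans_eq heq) (not_le.2 (hlt J hne.1 hne.2))
  rcases hI' with rfl | rfl <;> rcases hJ' with rfl | rfl
  · exact absurd rfl hIJ
  · exact hL'
  · rwa [inter_comm]
  · exact absurd rfl hIJ

/-- Enumerating the soliton pairs enumerates the unbounded line-solitons. -/
theorem exists_enumeration (hκ : StrictMono κ) (hgen : IsGeneric k κ) (hs : s ≠ 0)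
    (hbasis : ∃ I, IsColumnBasis A.col I) (t : ℝ) {m : ℕ} {p q : Fin m → Fin n}
    (hinj : ∀ r r', p r = p r' → q r = q r' → r = r')
    (hpair : ∀ a b, IsSolitonPair κ A s a b ↔ ∃ r, p r = a ∧ q r = b) :
    ∃ L : Fin m → Set (ℝ × ℝ), Function.Injective L ∧
      Set.range L = unboundedSolitons κ A t s ∧ ∀ r, HasType κ A t (L r) (p r) (q r) := by
  have hp : ∀ r, IsSolitonPair κ A s (p r) (q r) := fun r => (hpair _ _).2 ⟨r, rfl, rfl⟩
  choose L hL using fun r => (hp r).exists_soliton hκ hgen hs hbasis t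
  have hspec := fun r => (hL r).spec hκ hgen hs (hp r).1
  refine ⟨L, fun r r' h => ?_, subset_antisymm ?_ fun L' hL' => ?_, fun r => (hspec r).2.1⟩
  · have := (hL r).left_unique hκ hgen hs (hp r).1 (hp r').1 (h ▸ hL r')
    exact hinj r r' this.1 this.2
  · rintro _ ⟨r, rfl⟩
    exact (hspec r).1
  · obtain ⟨a, b, hab, h⟩ := exists_pair_of_mem_unboundedSolitons hκ hgen hs hbasis hL'
    obtain ⟨r, rfl, rfl⟩ := (hpair a b).1 hab
    exact ⟨r, (hL r).right_unique (hp r).1 h⟩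

theorem isSolitonPair_one_iff (hκ : StrictMono κ) {a b : Fin n} :
    IsSolitonPair κ A 1 a b ↔ a < b ∧ NecklaceRel A.col b a := by
  refine and_congr_right fun hab => ?_
  have : {l | 0 < (1 : ℝ) * ((κ l - κ a) * (κ l - κ b))} = cyclicInterval b a := by
    ext l
    rw [mem_cyclicInterval, mem_ofPred_eq, one_mul, mul_pos_iff, sub_pos, sub_pos, sub_neg,
      sub_neg, hκ.lt_iff_lt, hκ.lt_iff_lt, hκ.lt_iff_lt, hκ.lt_iff_lt]
    simp only [Fin.lt_def] at *
    omega
  rw [this, NecklaceRel]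
  exact ⟨fun h => ⟨hab.ne, h.symm⟩, fun h => h.2.symm⟩

theorem isSolitonPair_neg_one_iff (hκ : StrictMono κ) {a b : Fin n} :
    IsSolitonPair κ A (-1) a b ↔ a < b ∧ NecklaceRel A.col a b := by
  refine and_congr_right fun hab => ?_
  have : {l | 0 < (-1 : ℝ) * ((κ l - κ a) * (κ l - κ b))} = cyclicInterval a b := by
    ext l
    rw [mem_cyclicInterval, mem_ofPred_eq, neg_one_mul, neg_pos, mul_neg_iff, sub_pos, sub_pos,
      sub_neg, sub_neg, hκ.lt_iff_lt, hκ.lt_iff_lt, hκ.lt_iff_lt, hκ.lt_iff_lt]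
    simp only [Fin.lt_def] at *
    omega
  rw [this, NecklaceRel]
  exact ⟨fun h => ⟨hab.ne', h⟩, fun h => h.2⟩

end Solitons

/-! ### The cell of the permutation and the final assembly -/

theorem mem_positroidCellOfPerm {k n : ℕ} {M : Set (KSubset k n)}
    {A : Matrix (Fin k) (Fin n) ℝ} (hA : A ∈ positroidCell M)
    (hspan : ∀ i, A.col i ∈ Submodule.span ℝ (A.col '' {i}ᶜ))
    {π : Equiv.Perm (Fin n)} (hπ : ∀ i j, π j = i ↔ NecklaceRel A.col i j) :
    A ∈ positroidCellOfPerm k π := by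
  have hM : ∀ J, J ∈ M ↔ IsColumnBasis A.col J.1 := fun J => by
    rw [← minor_ne_zero_iff]
    refine ⟨fun h => (hA.2.1 J h).ne', fun h => ?_⟩
    by_contra hJ
    exact h (hA.2.2 J hJ)
  choose N hN hgreedy hlex using exists_greedyBasis (exists_isColumnBasis hA.1)
  refine ⟨M, fun r => ⟨N r, (hN r).card_eq⟩, hA, fun r => ⟨(hM _).2 (hN r), fun J hJ hne => ?_⟩,
    fun i => ?_⟩
  · exact hlex r J.1 ((hM J).1 hJ) (fun h => hne (Subtype.ext h)) ((hN r).card_eq.trans J.2.symm)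
  · have hij : NecklaceRel A.col i (π.symm i) := (hπ _ _).1 (π.apply_symm_apply i)
    exact ⟨π.symm i, hij.1, greedyBasis_finRotate hspan hgreedy hij, π.apply_symm_apply i⟩

end KPSoliton

theorem mainTheorem6 {k n : ℕ} (κ : Fin n → ℝ) (hκ : StrictMono κ)
    (hgen : KPSoliton.IsGeneric k κ)
    (M : Set (KPSoliton.KSubset k n)) (hM : KPSoliton.IsIrreducibleCell M)
    (A : Matrix (Fin k) (Fin n) ℝ) (hA : A ∈ KPSoliton.positroidCell M) (t₀ : ℝ) :
    ∃ (up : Fin k → Set (ℝ × ℝ)) (down : Fin (n - k) → Set (ℝ × ℝ))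
      (e j : Fin k → Fin n) (i g : Fin (n - k) → Fin n),
      (Function.Injective up ∧ Set.range up = KPSoliton.upperSolitons κ A t₀ ∧
        ∀ r, KPSoliton.HasType κ A t₀ (up r) (e r) (j r)) ∧
      (Function.Injective down ∧ Set.range down = KPSoliton.lowerSolitons κ A t₀ ∧
        ∀ r, KPSoliton.HasType κ A t₀ (down r) (i r) (g r)) ∧
      Function.Bijective (Sum.elim e g) ∧
      ∃ π : Equiv.Perm (Fin n), (∀ r, π (e r) = j r) ∧ (∀ r, π (g r) = i r) ∧
        (∀ a, π a ≠ a) ∧ (Finset.univ.filter fun a => a < π a).card = k ∧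
        A ∈ KPSoliton.positroidCellOfPerm k π := by
  have hbasis := KPSoliton.exists_isColumnBasis hA.1
  have hspan := hM.col_mem_span hA
  obtain ⟨π, hπ⟩ := KPSoliton.exists_perm_necklaceRel (hM.col_ne_zero hA) hspan
  have hfix : ∀ a, π a ≠ a := fun a h => ((hπ a a).1 h).1 rfl
  have hexc := KPSoliton.card_excedances hbasis (fun I hI => hI.card_eq) hπ
  have hcompl : (Finset.univ.filter fun a => a < π a)ᶜ.card = n - k := by
    rw [Finset.card_compl, hexc, Fintype.card_fin]
  have hmem : ∀ a, a ∈ (Finset.univ.filter fun a => a < π a)ᶜ ↔ π a < a := fun a => by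
    simpa using (hfix a).le_iff_lt
  let e := Finset.orderEmbOfFin _ hexc
  let g := Finset.orderEmbOfFin _ hcompl
  have he : ∀ a, (∃ r, e r = a) ↔ a < π a := fun a => by
    have := Set.ext_iff.1 (Finset.range_orderEmbOfFin _ hexc) a
    rwa [Finset.mem_coe, Finset.mem_filter_univ] at this
  have hg : ∀ a, (∃ r, g r = a) ↔ π a < a := fun a => by
    have := Set.ext_iff.1 (Finset.range_orderEmbOfFin _ hcompl) a
    rwa [Finset.mem_coe, hmem] at this
  -- For `s = 1` the smaller index of a pair is the excedance; for `s = -1` below, the larger index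
  -- is the non-excedance.
  obtain ⟨up, hup⟩ := KPSoliton.exists_enumeration (A := A) (s := 1) (p := e) (q := π ∘ e) hκ hgen
    one_ne_zero hbasis t₀ (fun r r' h _ => e.injective h) (fun a b => by
      rw [KPSoliton.isSolitonPair_one_iff hκ, ← hπ]
      constructor
      · rintro ⟨hab, rfl⟩
        obtain ⟨r, rfl⟩ := (he a).2 hab
        exact ⟨r, rfl, rfl⟩
      · rintro ⟨r, rfl, rfl⟩
        exact ⟨(he _).1 ⟨r, rfl⟩, rfl⟩)
  obtain ⟨down, hdown⟩ := KPSoliton.exists_enumeration (A := A) (s := -1) (p := π ∘ g) (q := g) hκ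
    hgen (neg_ne_zero.2 one_ne_zero) hbasis t₀ (fun r r' _ h => g.injective h) (fun a b => by
      rw [KPSoliton.isSolitonPair_neg_one_iff hκ, ← hπ]
      constructor
      · rintro ⟨hab, rfl⟩
        obtain ⟨r, rfl⟩ := (hg b).2 hab
        exact ⟨r, rfl, rfl⟩
      · rintro ⟨r, rfl, rfl⟩
        exact ⟨(hg _).1 ⟨r, rfl⟩, rfl⟩)
  rw [KPSoliton.unboundedSolitons_one] at hup
  rw [KPSoliton.unboundedSolitons_neg_one] at hdown
  refine ⟨up, down, e, π ∘ e, π ∘ g, g, hup, hdown, ⟨?_, fun a => ?_⟩, π, fun _ => rfl,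
    fun _ => rfl, hfix, hexc, KPSoliton.mem_positroidCellOfPerm hA hspan hπ⟩
  · refine Function.Injective.sumElim e.injective g.injective fun r r' h => ?_
    exact lt_asymm ((he _).1 ⟨r, rfl⟩) ((hg _).1 ⟨r', h.symm⟩)
  · rcases (hfix a).lt_or_gt with h | h
    · obtain ⟨r, hr⟩ := (hg a).2 h
      exact ⟨Sum.inr r, hr⟩
    · obtain ⟨r, hr⟩ := (he a).2 h
      exact ⟨Sum.inl r, hr⟩
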